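/- **Theorem (Sinkhorn error concentration).** Let $\mathcal X\subset\mathbb R^d$ be compact, let $\rho$ be a Borel probability measure on $\mathcal X$, and let $K_0,K_1:\mathcal X\times\mathcal X\to\mathbb R$ be continuous, symmetric, positive semidefinite kernels (covariance functions of Gaussian processes). Denote also by $K_i$ the covariance operator $[K_i\phi](x)=\int_{\mathcal X}K_i(x,s)\phi(s)\,d\rho(s)$ on $L^2(\mathcal X,\rho)$, and put $\kappa_i=\sup_{x,y\in\mathcal X}|K_i(x,y)|$. Let $\epsilon>0$. For covariance operators $A,B$ let $$M_\epsilon(A,B)=-I+\Big(I+\tfrac{16}{\epsilon^2}A^{1/2}BA^{1/2}\Big)^{1/2},$$ $$W_{2,\epsilon}^2(A,B)=\mathrm{Tr}[A]+\mathrm{Tr}[B]+\tfrac{\epsilon}{2}\log\det\big(I+\tfrac12M_\epsilon(A,B)\big)-\tfrac{\epsilon}{2}\mathrm{Tr}[M_\epsilon(A,B)],$$ where $\det$ is the Fredholm determinant, and let $S_{2,\epsilon}(A,B)=W_{2,\epsilon}^2(A,B)-\tfrac12\big(W_{2,\epsilon}^2(A,A)+W_{2,\epsilon}^2(B,B)\big)$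 be the 2-Sinkhorn divergence between covariance operators. Let $n\ge1$, let $x_1,\dots,x_n$ be i.i.d. random points of $\mathcal X$ with law $\rho$, and let $\Sigma_i$ be the $n\times n$ matrix with entries $(\Sigma_i)_{jk}=\frac1nK_i(x_j,x_k)$. For a square matrix $A$ such that $I+A$ has only positive eigenvalues let $$F(A)=\mathrm{Tr}\big[-I+(I+A)^{1/2}\big]-\log\det\big(\tfrac12I+\tfrac12(I+A)^{1/2}\big),$$ with the principal square root, and put, for $i,j\in\{0,1\}$, $$W_{2,\epsilon}^2(K_i,K_j,n)=\mathrm{Tr}[\Sigma_i+\Sigma_j]-\tfrac{\epsilon}{2}F\big(\tfrac{16}{\epsilon^2}\Sigma_i\Sigma_j\big),$$ $$S_{2,\epsilon}(K_0,K_1,n)=W_{2,\epsilon}^2(K_0,K_1,n)-\tfrac12\big(W_{2,\epsilon}^2(K_0,K_0,n)+W_{2,\epsilon}^2(K_1,K_1,n)\big).$$ Then for every $\theta\ge0$, with probability at least $1-4e^{-\theta}$, $$\big|S_{2,\epsilon}(K_0,K_1)-S_{2,\epsilon}(K_0,K_1,n)\big|\le\frac{8\sqrt2\,(\kappa_0+\kappa_1)^2}{\epsilon}\sqrt{\frac{\theta}{n}}.$$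 -/

import Mathlib

open MeasureTheory ProbabilityTheory

noncomputable section

namespace GPSinkhorn

section Operators

variable {H : Type*} [NormedAddCommGroup H] [InnerProductSpace ℝ H] [CompleteSpace H]

/-- The trace `∑ₖ ⟨A eₖ, eₖ⟩` of an operator on a real Hilbert space, along a Hilbert basis `e`
(for a trace-class operator the sum does not depend on the basis). -/
def opTrace (A : H →L[ℝ] H) : ℝ :=
  ∑' k, inner ℝ (A ((exists_hilbertBasis ℝ H).choose_spec.choose k))
    ((exists_hilbertBasis ℝ H).choose_spec.choose k)

open Classical in
/-- The operator square root `A^{1/2}` of a positive self-adjoint operator `A`: the (unique)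
positive self-adjoint operator `B` with `B² = A`. The value is `0` if there is none. -/
def opSqrt (A : H →L[ℝ] H) : H →L[ℝ] H :=
  if h : ∃ B : H →L[ℝ] H, B.IsPositive ∧ B * B = A then h.choose else 0

/-- The Fredholm determinant `det (I + T) = ∏ₖ (1 + λₖ)` of a self-adjoint trace-class operator `T`,
the `λₖ` being its eigenvalues, repeated according to multiplicity. Only the nonzero eigenvalues,
which have finite multiplicity, contribute to the product. -/
def fredholmDet (T : H →L[ℝ] H) : ℝ :=
  ∏' μ : ℝ, (1 + μ) ^ Module.finrank ℝ (Module.End.eigenspace (T : H →ₗ[ℝ] H) μ)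

/-- `M_ε(A, B) = -I + (I + (16 / ε²) A^{1/2} B A^{1/2})^{1/2}`. -/
def opM (ε : ℝ) (A B : H →L[ℝ] H) : H →L[ℝ] H :=
  -1 + opSqrt (1 + (16 / ε ^ 2) • (opSqrt A * B * opSqrt A))

/-- The squared entropy-regularized 2-Wasserstein distance between covariance operators,
`Tr A + Tr B + (ε/2) log det (I + M_ε(A, B) / 2) - (ε/2) Tr M_ε(A, B)`. -/
def opW2 (ε : ℝ) (A B : H →L[ℝ] H) : ℝ :=
  opTrace A + opTrace B + ε / 2 * Real.log (fredholmDet ((1 / 2 : ℝ) • opM ε A B))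
    - ε / 2 * opTrace (opM ε A B)

/-- The 2-Sinkhorn divergence between covariance operators. -/
def opSinkhorn (ε : ℝ) (A B : H →L[ℝ] H) : ℝ :=
  opW2 ε A B - 1 / 2 * (opW2 ε A A + opW2 ε B B)

end Operators

section Kernels

variable {X : Type*} [TopologicalSpace X] [CompactSpace X] [MeasurableSpace X] [BorelSpace X]

theorem integral_kernel_eq_inner (ρ : Measure X) [IsFiniteMeasure ρ] (K : C(X × X, ℝ))
    (φ : Lp ℝ 2 ρ) (x : X) :
    ∫ s, K (x, s) * φ s ∂ρ = inner ℝ (ContinuousMap.toLp 2 ρ ℝ (K.curry x)) φ := by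
  rw [L2.inner_def]
  apply integral_congr_ae
  filter_upwards [ContinuousMap.coeFn_toLp (p := 2) (𝕜 := ℝ) ρ (K.curry x)] with s hs
  rw [hs]
  simp [mul_comm]

theorem continuous_integral_kernel (ρ : Measure X) [IsFiniteMeasure ρ] (K : C(X × X, ℝ))
    (φ : Lp ℝ 2 ρ) : Continuous fun x => ∫ s, K (x, s) * φ s ∂ρ := by
  simp_rw [integral_kernel_eq_inner]
  fun_prop

/-- The covariance operator `[K φ](x) = ∫ K(x, s) φ(s) dρ(s)` on `L²(X, ρ)`. -/
def covOp (ρ : Measure X) [IsFiniteMeasure ρ] (K : C(X × X, ℝ)) : Lp ℝ 2 ρ →L[ℝ] Lp ℝ 2 ρ :=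
  LinearMap.mkContinuous
    { toFun := fun φ => ContinuousMap.toLp 2 ρ ℝ
        ⟨fun x => ∫ s, K (x, s) * φ s ∂ρ, continuous_integral_kernel ρ K φ⟩
      map_add' := fun φ ψ => by
        rw [← map_add]
        congr 1
        ext x
        change ∫ s, K (x, s) * (φ + ψ : Lp ℝ 2 ρ) s ∂ρ
          = ∫ s, K (x, s) * φ s ∂ρ + ∫ s, K (x, s) * ψ s ∂ρ
        simp only [integral_kernel_eq_inner, inner_add_right]
      map_smul' := fun c φ => by
        rw [RingHom.id_apply, ← map_smul]
        congr 1
        ext x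
        change ∫ s, K (x, s) * (c • φ : Lp ℝ 2 ρ) s ∂ρ = c * ∫ s, K (x, s) * φ s ∂ρ
        simp only [integral_kernel_eq_inner, real_inner_smul_right] }
    (‖(ContinuousMap.toLp 2 ρ ℝ : C(X, ℝ) →L[ℝ] Lp ℝ 2 ρ)‖ *
      (‖(ContinuousMap.toLp 2 ρ ℝ : C(X, ℝ) →L[ℝ] Lp ℝ 2 ρ)‖ * ‖K.curry‖))
    (fun φ => by
      refine (ContinuousLinearMap.le_opNorm
        (ContinuousMap.toLp 2 ρ ℝ : C(X, ℝ) →L[ℝ] Lp ℝ 2 ρ) _).trans ?_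
      rw [mul_assoc]
      refine mul_le_mul_of_nonneg_left ?_ (norm_nonneg _)
      rw [ContinuousMap.norm_le _ (by positivity)]
      intro x
      change ‖∫ s, K (x, s) * φ s ∂ρ‖ ≤ _
      rw [integral_kernel_eq_inner]
      refine (norm_inner_le_norm _ _).trans ?_
      refine mul_le_mul_of_nonneg_right ?_ (norm_nonneg _)
      refine (ContinuousLinearMap.le_opNorm
        (ContinuousMap.toLp 2 ρ ℝ : C(X, ℝ) →L[ℝ] Lp ℝ 2 ρ) _).trans ?_
      exact mul_le_mul_of_nonneg_left (K.curry.norm_coe_le_norm x) (norm_nonneg _))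

/-- `κ = sup_{x, y} |K(x, y)|`. -/
def kernelSup (K : C(X × X, ℝ)) : ℝ := ⨆ p : X × X, |K p|

end Kernels

section Empirical

open Classical in
/-- The principal square root of a real square matrix `A`: the (unique) matrix `B` with `B² = A`
whose complex eigenvalues all have positive real part (it exists if `A` has no eigenvalue in
`(-∞, 0]`). The value is `0` if there is none. -/
def matSqrt {n : ℕ} (A : Matrix (Fin n) (Fin n) ℝ) : Matrix (Fin n) (Fin n) ℝ :=
  if h : ∃ B : Matrix (Fin n) (Fin n) ℝ,
      B * B = A ∧ ∀ z ∈ spectrum ℂ (B.map (algebraMap ℝ ℂ)), 0 < z.re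
  then h.choose else 0

/-- `F(A) = Tr[-I + (I + A)^{1/2}] - log det (I/2 + (I + A)^{1/2} / 2)`. -/
def matF {n : ℕ} (A : Matrix (Fin n) (Fin n) ℝ) : ℝ :=
  (-1 + matSqrt (1 + A)).trace
    - Real.log ((1 / 2 : ℝ) • (1 : Matrix (Fin n) (Fin n) ℝ) + (1 / 2 : ℝ) • matSqrt (1 + A)).det

/-- The normalized Gram matrix `Σ_{ij} = K(xᵢ, xⱼ) / n` of a kernel at the points `x₁, …, xₙ`. -/
def gramMat {X : Type*} (K : X × X → ℝ) {n : ℕ} (x : Fin n → X) : Matrix (Fin n) (Fin n) ℝ :=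
  Matrix.of fun i j => 1 / (n : ℝ) * K (x i, x j)

/-- The estimator `W²_{2,ε}(K₀, K₁, n) = Tr[Σ₀ + Σ₁] - (ε/2) F((16 / ε²) Σ₀ Σ₁)`. -/
def empW2 {X : Type*} (ε : ℝ) (K₀ K₁ : X × X → ℝ) {n : ℕ} (x : Fin n → X) : ℝ :=
  (gramMat K₀ x + gramMat K₁ x).trace
    - ε / 2 * matF ((16 / ε ^ 2) • (gramMat K₀ x * gramMat K₁ x))

/-- The empirical 2-Sinkhorn divergence `S_{2,ε}(K₀, K₁, n)`. -/
def empSinkhorn {X : Type*} (ε : ℝ) (K₀ K₁ : X × X → ℝ) {n : ℕ} (x : Fin n → X) : ℝ :=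
  empW2 ε K₀ K₁ x - 1 / 2 * (empW2 ε K₀ K₀ x + empW2 ε K₁ K₁ x)

end Empirical

end GPSinkhorn

end

open MeasureTheory ProbabilityTheory

noncomputable section

namespace GPSinkhorn

/-! ### Square roots and eigenbases of operators on a Hilbert space -/

section HilbertSpace

variable {H : Type*} [NormedAddCommGroup H] [InnerProductSpace ℝ H]

/-! The traces cancel in the Sinkhorn divergence, so only the entropic parts have to be compared. If
`A = T₀ T₀*` and `B = T₁ T₁*`, the entropic part is `-(ε/2) ∑ h(4 sᵢ / ε)`, where `h` is
`entropyFun` and the `sᵢ` are the nonzero singular values of `T₀* T₁`. Factor both kernels through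
continuous feature maps `φ`, `ψ` into Hilbert spaces. The covariance operators then give the
population cross-covariance `E[φ(x) ⊗ ψ(x)]`, and the Gram matrices give the empirical mean of the
`φ(xⱼ) ⊗ ψ(xⱼ)`. Both are operators between the same two feature spaces, so they can be subtracted
(`exists_isSVD_opW2`, `exists_isSVD_empW2`).

On operators of Hilbert-Schmidt norm at most `C`, the map `R ↦ ∑ h(a sᵢ(R))` is Lipschitz with
constant `a² C / 2` (`IsSVD.abs_tsum_entropyFun_sub_le`). This is a convexity argument: `h` has
slope at most `t / 2`, and Fenchel duality with a von Neumann type trace inequality compares the two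
spectra.

It remains to bound the deviation of an empirical mean of Hilbert space vectors of norm at most `√κ₀
√κ₁`. Its expectation is controlled by the second moment, its fluctuation by McDiarmid's inequality
(`measure_meanDeviation_gt_le`). This is used for the pairs `(0,1)`, `(0,0)` and `(1,1)`; the errors
add up through `κ₀κ₁ + (κ₀² + κ₁²)/2 = (κ₀ + κ₁)²/2`. -/

theorem memℓp_mul_of_bounded {ι : Type*} {d : ι → ℝ} {C : ℝ} (hd : ∀ i, |d i| ≤ C)
    (f : lp (fun _ : ι => ℝ) 2) : Memℓp (fun i => d i * f i) 2 := by
  refine Memℓp.mono (g := fun i => C * ‖f i‖) ?_ fun i => ?_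
  · exact (memℓp_norm_iff.2 (lp.memℓp f)).const_mul C
  · rw [norm_mul]
    exact mul_le_mul_of_nonneg_right (hd i) (norm_nonneg _)

/-- Multiplication by a bounded function on `ℓ²`. -/
def lpMul {ι : Type*} {d : ι → ℝ} {C : ℝ} (hC : 0 ≤ C) (hd : ∀ i, |d i| ≤ C) :
    lp (fun _ : ι => ℝ) 2 →L[ℝ] lp (fun _ : ι => ℝ) 2 :=
  LinearMap.mkContinuous
    { toFun := fun f => ⟨fun i => d i * f i, memℓp_mul_of_bounded hd f⟩
      map_add' := fun f g => lp.ext (funext fun i => mul_add (d i) (f i) (g i))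
      map_smul' := fun c f => lp.ext (funext fun i => mul_left_comm (d i) c (f i)) } C
    (fun f => by
      have h2 : (0 : ℝ) < (2 : ENNReal).toReal := by simp
      refine lp.norm_le_of_forall_sum_le h2 (by positivity) fun s => ?_
      have h := lp.sum_rpow_le_norm_rpow h2 f s
      rw [Real.mul_rpow hC (norm_nonneg _)]
      refine le_trans ?_ (mul_le_mul_of_nonneg_left h (by positivity))
      rw [Finset.mul_sum]
      refine Finset.sum_le_sum fun i _ => ?_
      rw [← Real.mul_rpow hC (norm_nonneg _)]
      refine Real.rpow_le_rpow (norm_nonneg _) ?_ h2.le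
      change ‖d i * f i‖ ≤ _
      rw [norm_mul]
      exact mul_le_mul_of_nonneg_right (hd i) (norm_nonneg _))

theorem clm_ext_hilbertBasis {ι : Type*} (b : HilbertBasis ι ℝ H) {F : Type*}
    [NormedAddCommGroup F] [NormedSpace ℝ F] {A B : H →L[ℝ] F} (h : ∀ i, A (b i) = B (b i)) :
    A = B := by
  refine ContinuousLinearMap.ext_on (s := Set.range b) ?_ ?_
  · exact Submodule.dense_iff_topologicalClosure_eq_top.2 b.dense_span
  · rintro _ ⟨i, rfl⟩
    exact h i

/-- An operator that is diagonal in a Hilbert basis with nonnegative entries has a positive square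
root. -/
theorem exists_isPositive_sqrt {ι : Type*} (b : HilbertBasis ι ℝ H) {A : H →L[ℝ] H} {l : ι → ℝ}
    (hA : ∀ i, A (b i) = l i • b i) (hl : ∀ i, 0 ≤ l i) :
    ∃ B : H →L[ℝ] H, B.IsPositive ∧ B * B = A := by
  classical
  have hd : ∀ i, |√(l i)| ≤ √‖A‖ := fun i => by
    rw [abs_of_nonneg (Real.sqrt_nonneg _)]
    refine Real.sqrt_le_sqrt ?_
    have h := A.le_opNorm (b i)
    rwa [hA, norm_smul, b.orthonormal.1 i, mul_one, mul_one, Real.norm_of_nonneg (hl i)] at h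
  let D := lpMul (Real.sqrt_nonneg ‖A‖) hd
  have hDapp : ∀ f i, (D f) i = √(l i) * f i := fun f i => rfl
  let B : H →L[ℝ] H := (b.repr.symm.toContinuousLinearEquiv : _ →L[ℝ] H) ∘L D ∘L
    (b.repr.toContinuousLinearEquiv : H →L[ℝ] _)
  have hB : ∀ x, b.repr (B x) = D (b.repr x) := fun x => by simp [B]
  have hin : ∀ x y, inner ℝ (B x) y = ∑' i, √(l i) * (b.repr x i * b.repr y i) := fun x y => by
    rw [← b.repr.inner_map_map, hB, lp.inner_eq_tsum]
    refine tsum_congr fun i => ?_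
    rw [hDapp]
    simp
    ring
  refine ⟨B, ?_, ?_⟩
  · rw [ContinuousLinearMap.isPositive_iff]
    refine ⟨fun x y => ?_, fun x => ?_⟩
    · have h1 := hin x y
      have h2 := hin y x
      rw [real_inner_comm] at h2
      change inner ℝ (B x) y = inner ℝ x (B y)
      rw [h1, h2]
      exact tsum_congr fun i => by ring
    · rw [hin]
      exact tsum_nonneg fun i => mul_nonneg (Real.sqrt_nonneg _) (mul_self_nonneg _)
  · refine clm_ext_hilbertBasis b fun i => b.repr.injective ?_
    change b.repr (B (B (b i))) = _
    rw [hB, hB, hA]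
    refine lp.ext (funext fun j => ?_)
    rw [hDapp, hDapp, ← mul_assoc, Real.mul_self_sqrt (hl j), map_smul]
    rw [HilbertBasis.repr_self, lp.coeFn_smul, Pi.smul_apply, smul_eq_mul, lp.single_apply]
    rcases eq_or_ne j i with rfl | hij
    · rfl
    · simp [hij]

/-- A positive square root acts on eigenvectors as the root of the eigenvalue. -/
theorem sqrt_apply_eigenvector {A B : H →L[ℝ] H} (hB : B.IsPositive) (hBA : B * B = A) {l : ℝ}
    (hl : 0 ≤ l) {e : H} (he : A e = l • e) : B e = √l • e := by
  have hsym : ∀ x y, inner ℝ (B x) y = inner ℝ x (B y) := hB.isSymmetric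
  have hBB : B (B e) = l • e := by rw [← he, ← hBA]; rfl
  rcases hl.eq_or_lt with rfl | hl'
  · rw [Real.sqrt_zero, zero_smul]
    have : inner ℝ (B e) (B e) = 0 := by rw [← hsym, hBB, zero_smul, inner_zero_left]
    exact inner_self_eq_zero.1 this
  -- `y` is an eigenvector of `B` for `-√l` or zero; positivity of `B` rules out the former.
  · set y := B e - √l • e with hy
    have h1 : B y = -(√l • y) := by
      rw [hy, map_sub, map_smul, hBB, smul_sub, smul_smul, Real.mul_self_sqrt hl]
      abel
    have h2 : 0 ≤ inner ℝ (B y) y := hB.inner_nonneg_left y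
    rw [h1, inner_neg_left, real_inner_smul_left, real_inner_self_eq_norm_sq] at h2
    have h3 : 0 < √l := Real.sqrt_pos.2 hl'
    have h4 : ‖y‖ ^ 2 = 0 := by nlinarith [sq_nonneg ‖y‖]
    have h5 : y = 0 := by simpa using h4
    exact sub_eq_zero.1 h5

/-- A compact symmetric operator has a Hilbert basis of eigenvectors. -/
theorem exists_hilbertBasis_eigenvectors.{u} {H : Type u} [NormedAddCommGroup H] [InnerProductSpace ℝ H]
    [CompleteSpace H] {T : H →L[ℝ] H} (hT : IsCompactOperator T)
    (hsym : (T : H →ₗ[ℝ] H).IsSymmetric) :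
    ∃ (ι : Type u) (b : HilbertBasis ι ℝ H) (l : ι → ℝ), ∀ i, T (b i) = l i • b i := by
  have hbot := ContinuousLinearMap.orthogonalComplement_iSup_eigenspaces_eq_bot hT hsym
  let V : ℝ → Submodule ℝ H := fun μ => Module.End.eigenspace (T : H →ₗ[ℝ] H) μ
  have hc : ∀ μ, CompleteSpace (V μ) := fun μ => by
    have : IsClosed (V μ : Set H) := by
      have : (V μ : Set H) = {x | T x = μ • x} := by
        ext x; exact Module.End.mem_eigenspace_iff
      rw [this]
      exact isClosed_eq T.continuous (continuous_const_smul μ)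
    exact this.completeSpace_coe
  choose w e he using fun μ => exists_hilbertBasis ℝ (V μ)
  let v : (Σ μ, w μ) → H := fun i => (e i.1 i.2 : H)
  have hv : Orthonormal ℝ v :=
    hsym.orthogonalFamily_eigenspaces.orthonormal_sigma_orthonormal fun μ => (e μ).orthonormal
  refine ⟨_, HilbertBasis.mkOfOrthogonalEqBot hv ?_, fun i => i.1, fun i => ?_⟩
  · rw [eq_bot_iff, ← hbot]
    intro x hx
    rw [Submodule.mem_orthogonal'] at hx ⊢
    suffices h : ⨆ μ, V μ ≤ LinearMap.ker ((innerSL ℝ x : H →L[ℝ] ℝ) : H →ₗ[ℝ] ℝ) from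
      fun u hu => h hu
    refine iSup_le fun μ y hy => ?_
    -- Orthogonality to a Hilbert basis of each eigenspace gives orthogonality to the whole
    -- eigenspace.
    have h0 : (innerSL ℝ x : H →L[ℝ] ℝ) ∘L (V μ).subtypeL = 0 :=
      clm_ext_hilbertBasis (e μ) fun i =>
        hx _ (Submodule.subset_span ⟨(⟨μ, i⟩ : Σ μ, w μ), rfl⟩)
    exact congrArg (fun f => f ⟨y, hy⟩) h0
  · rw [HilbertBasis.coe_mkOfOrthogonalEqBot]
    exact Module.End.mem_eigenspace_iff.1 (e i.1 i.2).2

end HilbertSpace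

/-! ### Trace, Fredholm determinant and `opW2` of diagonal operators -/

section Diagonal

variable {H : Type*} [NormedAddCommGroup H] [InnerProductSpace ℝ H] {ι : Type*}
  {b : HilbertBasis ι ℝ H} {M : H →L[ℝ] H} {m : ι → ℝ}

theorem repr_apply_of_diagonal (hM : ∀ i, M (b i) = m i • b i) (x : H) (i : ι) :
    b.repr (M x) i = m i * b.repr x i := by
  classical
  have h : (innerSL ℝ (b i) : H →L[ℝ] ℝ) ∘L M = m i • (innerSL ℝ (b i) : H →L[ℝ] ℝ) := by
    refine clm_ext_hilbertBasis b fun j => ?_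
    simp only [ContinuousLinearMap.comp_apply, hM, map_smul, FunLike.coe_smul, Pi.smul_apply,
      innerSL_apply_apply, smul_eq_mul, orthonormal_iff_ite.1 b.orthonormal i j]
    rcases eq_or_ne i j with rfl | hij
    · rfl
    · simp [hij]
  rw [b.repr_apply_apply, b.repr_apply_apply]
  exact congrArg (fun f => f x) h

theorem hasSum_inner_of_diagonal (hM : ∀ i, M (b i) = m i • b i) (x y : H) :
    HasSum (fun i => m i * (inner ℝ (b i) x * inner ℝ (b i) y)) (inner ℝ (M x) y) := by
  have e : (fun i => m i * (inner ℝ (b i) x * inner ℝ (b i) y))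
      = fun i => inner ℝ (M x) (b i) * inner ℝ (b i) y := funext fun i => by
    rw [real_inner_comm (b i) (M x), ← b.repr_apply_apply (M x), repr_apply_of_diagonal hM,
      b.repr_apply_apply, mul_assoc]
  rw [e]
  exact b.hasSum_inner_mul_inner (M x) y

/-- An eigenvector for `μ` has zero coordinates off the fibre of `m` over `μ`. As the fibre is
finite, its expansion is a finite sum, so no closure of the span is needed. -/
theorem finrank_eigenspace_of_diagonal (hM : ∀ i, M (b i) = m i • b i) {μ : ℝ}
    (hfin : {i | m i = μ}.Finite) :
    Module.finrank ℝ (Module.End.eigenspace (M : H →ₗ[ℝ] H) μ) = Nat.card {i // m i = μ} := by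
  have hspan : Module.End.eigenspace (M : H →ₗ[ℝ] H) μ
      = Submodule.span ℝ (Set.range fun i : {i // m i = μ} => b i) := by
    apply le_antisymm
    · intro x hx
      have hx' : M x = μ • x := Module.End.mem_eigenspace_iff.1 hx
      have h0 : ∀ i, m i ≠ μ → b.repr x i = 0 := fun i hi => by
        have h1 := repr_apply_of_diagonal hM x i
        rw [hx', map_smul, lp.coeFn_smul, Pi.smul_apply, smul_eq_mul] at h1
        have h2 : (m i - μ) * b.repr x i = 0 := by linarith
        exact (mul_eq_zero.1 h2).resolve_left (sub_ne_zero.2 hi)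
      have hs : HasSum (fun i => b.repr x i • b i) (∑ i ∈ hfin.toFinset, b.repr x i • b i) :=
        hasSum_sum_of_ne_finset_zero fun i hi => by
          rw [h0 i (by simpa using hi), zero_smul]
      rw [(b.hasSum_repr x).unique hs]
      refine Submodule.sum_mem _ fun i hi => Submodule.smul_mem _ _ (Submodule.subset_span ?_)
      exact ⟨⟨i, by simpa using hi⟩, rfl⟩
    · rw [Submodule.span_le]
      rintro _ ⟨⟨i, rfl⟩, rfl⟩
      exact Module.End.mem_eigenspace_iff.2 (hM i)
  have : Fintype {i // m i = μ} := hfin.fintype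
  rw [hspan, finrank_span_eq_card, Nat.card_eq_fintype_card]
  exact b.orthonormal.linearIndependent.comp _ Subtype.val_injective

/-- `opTrace` uses an arbitrarily chosen basis. Nonnegativity allows the double sum to be
interchanged, and Parseval evaluates the inner sum. -/
theorem opTrace_of_diagonal [CompleteSpace H] (hM : ∀ i, M (b i) = m i • b i) (hm : ∀ i, 0 ≤ m i)
    (hs : Summable m) : opTrace M = ∑' i, m i := by
  unfold opTrace
  generalize (exists_hilbertBasis ℝ H).choose_spec.choose = e
  have h1 : ∀ i, HasSum (fun k => m i * (inner ℝ (b i) (e k) * inner ℝ (b i) (e k))) (m i) :=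
    fun i => by
      have h := (e.hasSum_inner_mul_inner (b i) (b i)).mul_left (m i)
      rw [real_inner_self_eq_norm_sq, b.orthonormal.1 i, one_pow, mul_one] at h
      simpa only [real_inner_comm (b i)] using h
  have hsum : Summable fun p : ι × _ => m p.1 * (inner ℝ (b p.1) (e p.2) * inner ℝ (b p.1) (e p.2)) := by
    rw [summable_prod_of_nonneg fun p => mul_nonneg (hm _) (mul_self_nonneg _)]
    refine ⟨fun i => (h1 i).summable, ?_⟩
    simpa only [(h1 _).tsum_eq] using hs
  calc _ = ∑' k, ∑' i, m i * (inner ℝ (b i) (e k) * inner ℝ (b i) (e k)) :=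
        tsum_congr fun k => (hasSum_inner_of_diagonal hM (e k) (e k)).tsum_eq.symm
    _ = ∑' i, ∑' k, m i * (inner ℝ (b i) (e k) * inner ℝ (b i) (e k)) := hsum.tsum_comm
    _ = _ := tsum_congr fun i => (h1 i).tsum_eq

/-- The sum over indices is regrouped along the fibres of `m`, whose sizes are the eigenvalue
multiplicities. -/
theorem log_fredholmDet_of_diagonal (hM : ∀ i, M (b i) = m i • b i) (hm : ∀ i, 0 ≤ m i)
    (hs : Summable m) : Real.log (fredholmDet M) = ∑' i, Real.log (1 + m i) := by
  have hls : Summable fun i => Real.log (1 + m i) :=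
    hs.of_nonneg_of_le (fun i => Real.log_nonneg (by linarith [hm i]))
      fun i => (Real.log_le_sub_one_of_pos (by linarith [hm i])).trans (by linarith)
  have hfin : ∀ μ : ℝ, μ ≠ 0 → {i | m i = μ}.Finite := fun μ hμ => by
    have h := hs.tendsto_cofinite_zero
    have h2 : ∀ᶠ i in Filter.cofinite, m i ≠ μ := h.eventually_ne hμ.symm
    simpa [Filter.eventually_cofinite] using h2
  have key : HasSum (fun μ : ℝ => (Module.finrank ℝ (Module.End.eigenspace (M : H →ₗ[ℝ] H) μ) : ℝ)
      * Real.log (1 + μ)) (∑' i, Real.log (1 + m i)) := by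
    have h := ((Equiv.sigmaFiberEquiv m).hasSum_iff.2 hls.hasSum).sigma (γ := fun μ => {i // m i = μ})
      (g := fun μ : ℝ => (Module.finrank ℝ (Module.End.eigenspace (M : H →ₗ[ℝ] H) μ) : ℝ)
      * Real.log (1 + μ)) 
    refine h fun μ => ?_
    have hc : ∀ i : {i // m i = μ}, Real.log (1 + m i) = Real.log (1 + μ) := fun i => by rw [i.2]
    simp only [Function.comp_apply, Equiv.sigmaFiberEquiv, Equiv.coe_fn_mk, hc]
    -- The kernel may be infinite-dimensional, but it contributes nothing because `log 1 = 0`.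
    rcases eq_or_ne μ 0 with rfl | hμ
    · simp
    · have : Fintype {i // m i = μ} := (hfin μ hμ).fintype
      rw [finrank_eigenspace_of_diagonal hM (hfin μ hμ), Nat.card_eq_fintype_card]
      simpa using hasSum_fintype fun _ : {i // m i = μ} => Real.log (1 + μ)
  have hprod : HasProd (fun μ : ℝ =>
      (1 + μ) ^ Module.finrank ℝ (Module.End.eigenspace (M : H →ₗ[ℝ] H) μ))
      (Real.exp (∑' i, Real.log (1 + m i))) := by
    convert key.rexp using 2 with μ
    rw [Function.comp_apply]
    rcases eq_or_ne μ 0 with rfl | hμ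
    · simp
    -- For negative `μ` the factor `1 + μ` may fail to be positive; the exponent vanishes there.
    rcases lt_or_ge μ 0 with hneg | hpos
    · have : IsEmpty {i // m i = μ} := ⟨fun i => by linarith [i.2, hm i]⟩
      rw [finrank_eigenspace_of_diagonal hM (hfin μ hμ)]
      simp
    · rw [← Real.log_pow, Real.exp_log (by positivity)]
  rw [fredholmDet, hprod.tprod_eq, Real.log_exp]

/-- The convex function `t ↦ √(1 + t²) - 1 - log ((1 + √(1 + t²)) / 2)`, whose sum over the singular
values is the entropic part of the Sinkhorn divergence. -/
def entropyFun (t : ℝ) : ℝ := √(1 + t ^ 2) - 1 - Real.log ((1 + √(1 + t ^ 2)) / 2)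

theorem opSqrt_spec {A : H →L[ℝ] H} (h : ∃ B : H →L[ℝ] H, B.IsPositive ∧ B * B = A) :
    (opSqrt A).IsPositive ∧ opSqrt A * opSqrt A = A := by
  rw [opSqrt, dif_pos h]
  exact h.choose_spec

theorem opSqrt_apply_of_diagonal (hM : ∀ i, M (b i) = m i • b i) (hm : ∀ i, 0 ≤ m i) (i : ι) :
    opSqrt M (b i) = √(m i) • b i :=
  have h := opSqrt_spec (exists_isPositive_sqrt b hM hm)
  sqrt_apply_eigenvector h.1 h.2 (hm i) (hM i)

/-- `opM` is diagonal in the same basis, with entries `r = √(1 + t²) - 1` for `t = (4/ε)√m`. Since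
`1 + r/2 = (1 + √(1 + t²))/2`, the trace and log-determinant terms combine into `entropyFun t`. -/
theorem opW2_of_diagonal [CompleteSpace H] {ε : ℝ} {A B : H →L[ℝ] H}
    (hM : ∀ i, (opSqrt A * B * opSqrt A) (b i) = m i • b i) (hm : ∀ i, 0 ≤ m i)
    (hs : Summable m) :
    opW2 ε A B = opTrace A + opTrace B - ε / 2 * ∑' i, entropyFun (4 / ε * √(m i)) := by
  have hsq : ∀ i, (4 / ε * √(m i)) ^ 2 = 16 / ε ^ 2 * m i := fun i => by
    rw [mul_pow, Real.sq_sqrt (hm i), div_pow]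
    norm_num
  have hc : ∀ i, 0 ≤ 16 / ε ^ 2 * m i := fun i => mul_nonneg (by positivity) (hm i)
  set r : ι → ℝ := fun i => √(1 + (4 / ε * √(m i)) ^ 2) - 1 with hr
  have hr0 : ∀ i, 0 ≤ r i := fun i =>
    sub_nonneg.2 (Real.one_le_sqrt.2 (le_add_of_nonneg_right (sq_nonneg _)))
  have hrs : Summable r := by
    refine (hs.mul_left (16 / ε ^ 2)).of_nonneg_of_le hr0 fun i => ?_
    rw [← hsq, hr]
    have h1 := sq_nonneg (4 / ε * √(m i))
    have h2 : √(1 + (4 / ε * √(m i)) ^ 2) ≤ 1 + (4 / ε * √(m i)) ^ 2 := by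
      rw [Real.sqrt_le_left (by positivity)]
      nlinarith
    simp only
    linarith
  have hopM : ∀ i, opM ε A B (b i) = r i • b i := fun i => by
    have h := opSqrt_apply_of_diagonal (b := b)
      (M := 1 + (16 / ε ^ 2) • (opSqrt A * B * opSqrt A)) (m := fun i => 1 + 16 / ε ^ 2 * m i)
      (fun i => by
        rw [add_smul, one_smul, ← smul_smul, ← hM]
        rfl) (fun i => by linarith [hc i]) i
    change -(b i) + opSqrt (1 + (16 / ε ^ 2) • (opSqrt A * B * opSqrt A)) (b i) = _
    rw [h, hr]
    simp only [hsq]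
    rw [sub_smul, one_smul]
    abel
  have hhalf : ∀ i, ((1 / 2 : ℝ) • opM ε A B) (b i) = (1 / 2 * r i) • b i := fun i => by
    rw [← smul_smul, ← hopM]
    rfl
  have hls : Summable fun i => Real.log (1 + 1 / 2 * r i) :=
    (hrs.mul_left (1 / 2)).of_nonneg_of_le (fun i => Real.log_nonneg (by linarith [hr0 i]))
      fun i => (Real.log_le_sub_one_of_pos (by linarith [hr0 i])).trans (by linarith)
  rw [opW2, opTrace_of_diagonal hopM hr0 hrs, log_fredholmDet_of_diagonal hhalf
    (fun i => by linarith [hr0 i]) (hrs.mul_left _)]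
  have : ∑' i, entropyFun (4 / ε * √(m i)) = ∑' i, r i - ∑' i, Real.log (1 + 1 / 2 * r i) := by
    rw [← hrs.tsum_sub hls]
    refine tsum_congr fun i => ?_
    rw [entropyFun, hr]
    simp only
    congr 2
    ring
  rw [this]
  ring

end Diagonal

/-! ### Fenchel duality for the entropy function -/

section EntropyFun

theorem one_le_sqrt_one_add_sq (t : ℝ) : 1 ≤ √(1 + t ^ 2) :=
  Real.one_le_sqrt.2 (le_add_of_nonneg_right (sq_nonneg _))

/-- Fenchel's inequality for `entropyFun`, whose conjugate is `v ↦ -log (1 - v²)`. -/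
theorem mul_add_log_le_entropyFun {v : ℝ} (t : ℝ) (hv0 : 0 ≤ v) (hv1 : v < 1) :
    t * v + Real.log (1 - v ^ 2) ≤ entropyFun t := by
  have hr1 := one_le_sqrt_one_add_sq t
  have hr2 : √(1 + t ^ 2) ^ 2 = 1 + t ^ 2 := Real.sq_sqrt (by positivity)
  unfold entropyFun
  set r := √(1 + t ^ 2)
  have hp : 0 < (1 + r) / 2 := by linarith
  have hq : 0 < 1 - v ^ 2 := by nlinarith
  have h1 := Real.log_le_sub_one_of_pos (mul_pos hp hq)
  rw [Real.log_mul hp.ne' hq.ne'] at h1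
  -- After `log x ≤ x - 1` for `x = (1+r)/2 · (1 - v²)`, what remains is the AM-GM inequality for
  -- `(r-1)/2` and `(r+1)/2 · v²`, because `(r-1)(r+1) = t²`.
  have h2 : t * v ≤ (1 + r) / 2 - 1 + (1 + r) / 2 * v ^ 2 := by
    have h3 : t ^ 2 = (r - 1) * (r + 1) := by linarith
    have h4 : (t * v) ^ 2 ≤ ((1 + r) / 2 - 1 + (1 + r) / 2 * v ^ 2) ^ 2 := by
      rw [mul_pow, h3]
      nlinarith [sq_nonneg ((r - 1) / 2 - (1 + r) / 2 * v ^ 2)]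
    exact abs_le_of_sq_le_sq' h4 (by nlinarith [sq_nonneg v]) |>.2
  linarith

theorem entropyFun_nonneg (t : ℝ) : 0 ≤ entropyFun t := by
  simpa using mul_add_log_le_entropyFun t le_rfl zero_lt_one

theorem entropyFun_le (t : ℝ) : entropyFun t ≤ t ^ 2 := by
  have hr1 := one_le_sqrt_one_add_sq t
  have hr2 : √(1 + t ^ 2) ^ 2 = 1 + t ^ 2 := Real.sq_sqrt (by positivity)
  unfold entropyFun
  have h := Real.log_nonneg (x := (1 + √(1 + t ^ 2)) / 2) (by linarith)
  nlinarith

/-- The maximizer in Fenchel's equality for `entropyFun`, which is its derivative. -/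
def entropySlope (t : ℝ) : ℝ := t / (1 + √(1 + t ^ 2))

theorem entropySlope_nonneg {t : ℝ} (ht : 0 ≤ t) : 0 ≤ entropySlope t := by
  unfold entropySlope
  positivity

theorem entropySlope_lt_one (t : ℝ) : entropySlope t < 1 := by
  rw [entropySlope, div_lt_one (by positivity)]
  have := Real.le_sqrt_of_sq_le (show t ^ 2 ≤ 1 + t ^ 2 by linarith)
  linarith

theorem entropySlope_le {t : ℝ} (ht : 0 ≤ t) : entropySlope t ≤ t / 2 := by
  have hr1 := one_le_sqrt_one_add_sq t
  exact div_le_div_of_nonneg_left ht two_pos (by linarith)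

/-- With `r = √(1 + t²)` and `v = entropySlope t` one has `v² = (r-1)/(r+1)`, hence `1 - v² =
2/(1+r)`: both inequalities behind Fenchel's are saturated. -/
theorem entropyFun_eq (t : ℝ) :
    entropyFun t = t * entropySlope t + Real.log (1 - entropySlope t ^ 2) := by
  have hr1 := one_le_sqrt_one_add_sq t
  have hr2 : √(1 + t ^ 2) ^ 2 = 1 + t ^ 2 := Real.sq_sqrt (by positivity)
  unfold entropyFun entropySlope
  set r := √(1 + t ^ 2)
  have hp : 0 < 1 + r := by linarith
  have ht : t ^ 2 = (r - 1) * (r + 1) := by linarith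
  have h1 : t * (t / (1 + r)) = r - 1 := by
    field_simp
    linarith
  have h2 : 1 - (t / (1 + r)) ^ 2 = ((1 + r) / 2)⁻¹ := by
    rw [div_pow, ht]
    field_simp
    ring
  rw [h1, h2, Real.log_inv]
  ring

end EntropyFun

/-! ### Lipschitz bound for spectral sums in Hilbert-Schmidt norm -/

section SVD

open TensorProduct

variable {E G : Type*} [NormedAddCommGroup E] [InnerProductSpace ℝ E]
  [NormedAddCommGroup G] [InnerProductSpace ℝ G] {ι κ : Type*}

/-- A singular value decomposition `R = ∑ᵢ sᵢ uᵢ ⊗ wᵢ`. -/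
structure IsSVD (R : E →L[ℝ] G) (s : ι → ℝ) (u : ι → G) (w : ι → E) : Prop where
  nonneg : ∀ i, 0 ≤ s i
  left : Orthonormal ℝ u
  right : Orthonormal ℝ w
  apply_right : ∀ i, R (w i) = s i • u i
  hasSum : ∀ x y, HasSum (fun i => s i * (inner ℝ (w i) x * inner ℝ (u i) y)) (inner ℝ (R x) y)

/-- The element `Ψ` of the Hilbert tensor product represents the (Hilbert-Schmidt) operator `R`. -/
def Represents (Ψ : UniformSpace.Completion (G ⊗[ℝ] E)) (R : E →L[ℝ] G) : Prop :=
  ∀ g e, inner ℝ g (R e) = inner ℝ ((g ⊗ₜ[ℝ] e : G ⊗[ℝ] E) : UniformSpace.Completion (G ⊗[ℝ] E)) Ψ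

variable {R R' : E →L[ℝ] G} {Ψ Ψ' : UniformSpace.Completion (G ⊗[ℝ] E)}

theorem Represents.sub (h : Represents Ψ R) (h' : Represents Ψ' R') :
    Represents (Ψ - Ψ') (R - R') := fun g e => by
  rw [inner_sub_right, ← h, ← h', ← inner_sub_right]
  rfl

/-- Bessel's inequality for `Ψ` and the orthonormal family `uᵢ ⊗ wᵢ`. -/
theorem Represents.sum_sq_le (h : Represents Ψ R) {u : ι → G} {w : ι → E} (hu : Orthonormal ℝ u)
    (hw : Orthonormal ℝ w) (I : Finset ι) : ∑ i ∈ I, inner ℝ (u i) (R (w i)) ^ 2 ≤ ‖Ψ‖ ^ 2 := by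
  classical
  have ho : Orthonormal ℝ fun i =>
      ((u i ⊗ₜ[ℝ] w i : G ⊗[ℝ] E) : UniformSpace.Completion (G ⊗[ℝ] E)) := by
    rw [orthonormal_iff_ite] at hu hw ⊢
    intro i j
    rw [UniformSpace.Completion.inner_coe, TensorProduct.inner_tmul, hu, hw]
    split_ifs <;> simp
  refine le_trans (le_of_eq (Finset.sum_congr rfl fun i _ => ?_)) (ho.sum_inner_products_le (s := I) Ψ)
  rw [h, Real.norm_eq_abs, sq_abs]

theorem IsSVD.sum_sq_le {s : ι → ℝ} {u : ι → G} {w : ι → E} (hR : IsSVD R s u w)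
    (h : Represents Ψ R) (I : Finset ι) : ∑ i ∈ I, s i ^ 2 ≤ ‖Ψ‖ ^ 2 := by
  refine le_trans (le_of_eq (Finset.sum_congr rfl fun i _ => ?_)) (h.sum_sq_le hR.left hR.right I)
  rw [hR.apply_right, real_inner_smul_right, real_inner_self_eq_norm_sq, hR.left.1]
  ring

theorem IsSVD.summable_sq {s : ι → ℝ} {u : ι → G} {w : ι → E} (hR : IsSVD R s u w)
    (h : Represents Ψ R) : Summable fun i => s i ^ 2 :=
  summable_of_sum_le (fun _ => sq_nonneg _) (hR.sum_sq_le h)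

theorem IsSVD.summable_entropyFun {s : ι → ℝ} {u : ι → G} {w : ι → E} (hR : IsSVD R s u w)
    (h : Represents Ψ R) (a : ℝ) : Summable fun i => entropyFun (a * s i) := by
  refine ((hR.summable_sq h).mul_left (a ^ 2)).of_nonneg_of_le (fun i => entropyFun_nonneg _)
    fun i => (entropyFun_le _).trans (by rw [mul_pow])

/-- A trace inequality of von Neumann type, combined with Fenchel's inequality. -/
theorem IsSVD.sum_mul_inner_le {t : κ → ℝ} {p : κ → G} {q : κ → E} (hR : IsSVD R t p q)
    (hΨ : Represents Ψ R) {u : ι → G} {w : ι → E} (hu : Orthonormal ℝ u) (hw : Orthonormal ℝ w)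
    {a : ℝ} {v : ι → ℝ} (hv0 : ∀ i, 0 ≤ v i) (hv1 : ∀ i, v i < 1) (ha : 0 ≤ a)
    (I : Finset ι) :
    ∑ i ∈ I, (a * v i * inner ℝ (u i) (R (w i)) + Real.log (1 - v i ^ 2))
      ≤ ∑' j, entropyFun (a * t j) := by
  -- The averaged squared overlaps of the two singular systems form a doubly substochastic array: by
  -- Bessel, rows and columns sum to at most `1`.
  set m : ι → κ → ℝ := fun i j => (inner ℝ (q j) (w i) ^ 2 + inner ℝ (p j) (u i) ^ 2) / 2 with hm
  have hm0 : ∀ i j, 0 ≤ m i j := fun i j => by positivity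
  have hms : ∀ i, Summable (m i) := fun i => by
    have h1 := hR.right.inner_products_summable (w i)
    have h2 := hR.left.inner_products_summable (u i)
    simp only [Real.norm_eq_abs, sq_abs] at h1 h2
    exact (h1.add h2).div_const 2
  have hm1 : ∀ i, ∑' j, m i j ≤ 1 := fun i => by
    have h1 := hR.right.inner_products_summable (w i)
    have h2 := hR.left.inner_products_summable (u i)
    have h3 := hR.right.tsum_inner_products_le (w i)
    have h4 := hR.left.tsum_inner_products_le (u i)
    rw [hw.1 i] at h3
    rw [hu.1 i] at h4
    simp only [Real.norm_eq_abs, sq_abs] at h1 h2 h3 h4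
    rw [hm, tsum_div_const, h1.tsum_add h2]
    linarith
  have hm2 : ∀ j, ∑ i ∈ I, m i j ≤ 1 := fun j => by
    have h1 := hw.sum_inner_products_le (s := I) (q j)
    have h2 := hu.sum_inner_products_le (s := I) (p j)
    rw [hR.right.1 j] at h1
    rw [hR.left.1 j] at h2
    simp only [Real.norm_eq_abs, sq_abs] at h1 h2
    rw [hm, ← Finset.sum_div, Finset.sum_add_distrib]
    simp only [real_inner_comm (w _), real_inner_comm (u _)]
    linarith
  have hg0 : ∀ i, 0 ≤ -Real.log (1 - v i ^ 2) := fun i =>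
    neg_nonneg.2 (Real.log_nonpos (by nlinarith [hv0 i, hv1 i]) (by nlinarith [hv0 i]))
  have hes := hR.summable_entropyFun hΨ a
  have hme : ∀ i, Summable fun j => m i j * entropyFun (a * t j) := fun i => by
    refine hes.of_nonneg_of_le (fun j => mul_nonneg (hm0 i j) (entropyFun_nonneg _)) fun j => ?_
    refine mul_le_of_le_one_left (entropyFun_nonneg _) ?_
    exact ((hms i).le_tsum j fun j _ => hm0 i j).trans (hm1 i)
  have hterm : ∀ i, a * v i * inner ℝ (u i) (R (w i)) + Real.log (1 - v i ^ 2)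
      ≤ ∑' j, m i j * entropyFun (a * t j) := fun i => by
    have h1 := (hR.hasSum (w i) (u i)).mul_left (a * v i)
    rw [real_inner_comm] at h1
    -- The term `-log(1 - vᵢ²) ≥ 0` is weighted by row `i` together with `entropyFun`. Row sums at
    -- most `1` bound its weighted total by a single copy, which moves to the left side.
    have h2 : Summable fun j => m i j * (entropyFun (a * t j) + -Real.log (1 - v i ^ 2)) := by
      simpa only [mul_add] using (hme i).add ((hms i).mul_right _)
    have h3 : a * v i * inner ℝ (u i) (R (w i))
        ≤ ∑' j, m i j * (entropyFun (a * t j) + -Real.log (1 - v i ^ 2)) := by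
      refine hasSum_le (fun j => ?_) h1 h2.hasSum
      have h4 : inner ℝ (q j) (w i) * inner ℝ (p j) (u i) ≤ m i j := by
        rw [hm]
        nlinarith [sq_nonneg (inner ℝ (q j) (w i) - inner ℝ (p j) (u i))]
      have h5 := mul_add_log_le_entropyFun (a * t j) (hv0 i) (hv1 i)
      have h6 : 0 ≤ a * t j * v i := mul_nonneg (mul_nonneg ha (hR.nonneg j)) (hv0 i)
      calc _ = a * t j * v i * (inner ℝ (q j) (w i) * inner ℝ (p j) (u i)) := by ring
        _ ≤ a * t j * v i * m i j := mul_le_mul_of_nonneg_left h4 h6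
        _ = m i j * (a * t j * v i) := mul_comm _ _
        _ ≤ _ := mul_le_mul_of_nonneg_left (by linarith) (hm0 i j)
    simp only [mul_add] at h3
    rw [(hme i).tsum_add ((hms i).mul_right _), tsum_mul_right] at h3
    nlinarith [hg0 i, hm1 i]
  refine (Finset.sum_le_sum fun i _ => hterm i).trans ?_
  rw [← Summable.tsum_finsetSum fun i _ => hme i]
  refine Summable.tsum_le_tsum (fun j => ?_) (summable_sum fun i _ => hme i) hes
  rw [← Finset.sum_mul]
  exact mul_le_of_le_one_left (entropyFun_nonneg _) (hm2 j)

/-- A subgradient argument. With slopes `v` taken at the singular values of `R`, Fenchel's equality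
for `R` splits into a term in `R'`, bounded by the trace inequality, and a pairing of `v` with `R -
R'`. Cauchy-Schwarz bounds the pairing, since `vᵢ ≤ a sᵢ / 2`. -/
theorem IsSVD.tsum_entropyFun_sub_le {s : ι → ℝ} {u : ι → G} {w : ι → E} (hR : IsSVD R s u w)
    (hΨ : Represents Ψ R) {t : κ → ℝ} {p : κ → G} {q : κ → E} (hR' : IsSVD R' t p q)
    (hΨ' : Represents Ψ' R') {a : ℝ} (ha : 0 ≤ a) :
    ∑' i, entropyFun (a * s i) - ∑' j, entropyFun (a * t j)
      ≤ a ^ 2 / 2 * ‖Ψ‖ * ‖Ψ - Ψ'‖ := by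
  rw [sub_le_iff_le_add]
  refine (hR.summable_entropyFun hΨ a).tsum_le_of_sum_le fun I => ?_
  set v : ι → ℝ := fun i => entropySlope (a * s i) with hv
  have has : ∀ i, 0 ≤ a * s i := fun i => mul_nonneg ha (hR.nonneg i)
  have h1 := hR'.sum_mul_inner_le hΨ' hR.left hR.right (v := v) (a := a)
    (fun i => entropySlope_nonneg (has i)) (fun i => entropySlope_lt_one _) ha I
  have h2 : ∑ i ∈ I, entropyFun (a * s i)
      = ∑ i ∈ I, (a * v i * inner ℝ (u i) (R' (w i)) + Real.log (1 - v i ^ 2))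
        + a * ∑ i ∈ I, v i * inner ℝ (u i) ((R - R') (w i)) := by
    rw [Finset.mul_sum, ← Finset.sum_add_distrib]
    refine Finset.sum_congr rfl fun i _ => ?_
    rw [entropyFun_eq, sub_apply, inner_sub_right, hR.apply_right,
      real_inner_smul_right, real_inner_self_eq_norm_sq, hR.left.1]
    ring
  have h3 : ∑ i ∈ I, v i * inner ℝ (u i) ((R - R') (w i)) ≤ a / 2 * ‖Ψ‖ * ‖Ψ - Ψ'‖ := by
    refine (Real.sum_mul_le_sqrt_mul_sqrt _ _ _).trans ?_
    refine mul_le_mul ?_ ?_ (Real.sqrt_nonneg _) (by positivity)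
    · rw [Real.sqrt_le_left (by positivity)]
      calc ∑ i ∈ I, v i ^ 2 ≤ ∑ i ∈ I, (a / 2) ^ 2 * s i ^ 2 :=
            Finset.sum_le_sum fun i _ => by
              rw [← mul_pow]
              refine pow_le_pow_left₀ (entropySlope_nonneg (has i)) ?_ 2
              exact (entropySlope_le (has i)).trans (le_of_eq (by ring))
        _ ≤ (a / 2) ^ 2 * ‖Ψ‖ ^ 2 := by
            rw [← Finset.mul_sum]
            exact mul_le_mul_of_nonneg_left (hR.sum_sq_le hΨ I) (sq_nonneg _)
        _ = _ := by ring
    · rw [Real.sqrt_le_left (norm_nonneg _)]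
      exact (hΨ.sub hΨ').sum_sq_le hR.left hR.right I
  have h4 := mul_le_mul_of_nonneg_left h3 ha
  rw [h2]
  linarith

theorem IsSVD.abs_tsum_entropyFun_sub_le {s : ι → ℝ} {u : ι → G} {w : ι → E} (hR : IsSVD R s u w)
    (hΨ : Represents Ψ R) {t : κ → ℝ} {p : κ → G} {q : κ → E} (hR' : IsSVD R' t p q)
    (hΨ' : Represents Ψ' R') {a C : ℝ} (ha : 0 ≤ a) (hC : ‖Ψ‖ ≤ C) (hC' : ‖Ψ'‖ ≤ C) :
    |∑' i, entropyFun (a * s i) - ∑' j, entropyFun (a * t j)|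
      ≤ a ^ 2 / 2 * C * ‖Ψ - Ψ'‖ := by
  rw [abs_le, neg_le, neg_sub]
  constructor
  · refine (hR'.tsum_entropyFun_sub_le hΨ' hR hΨ ha).trans ?_
    rw [norm_sub_rev]
    gcongr
  · refine (hR.tsum_entropyFun_sub_le hΨ hR' hΨ' ha).trans ?_
    gcongr

end SVD

/-! ### Singular value decomposition of `T₀* T₁` -/

section SVDConstruction

variable {E G L : Type*} [NormedAddCommGroup E] [InnerProductSpace ℝ E] [CompleteSpace E]
  [NormedAddCommGroup G] [InnerProductSpace ℝ G] [CompleteSpace G]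
  [NormedAddCommGroup L] [InnerProductSpace ℝ L] [CompleteSpace L] {ι : Type*}

open ContinuousLinearMap in
/-- If `Q² = T₀ T₀*` with `Q` positive and `Q T₁ T₁* Q` is diagonal, then the eigenvectors of the latter
yield a singular value decomposition of `T₀* T₁`. -/
theorem exists_isSVD {T₀ : G →L[ℝ] L} {T₁ : E →L[ℝ] L} {Q : L →L[ℝ] L} (hQ : Q.IsPositive)
    (hQQ : Q * Q = T₀ ∘L adjoint T₀) {b : HilbertBasis ι ℝ L} {l : ι → ℝ}
    (hl : ∀ i, (Q * (T₁ ∘L adjoint T₁) * Q) (b i) = l i • b i) :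
    (∀ i, 0 ≤ l i) ∧ ∃ (u : {i // 0 < l i} → G) (w : {i // 0 < l i} → E),
      IsSVD (adjoint T₀ ∘L T₁) (fun i : {i // 0 < l i} => √(l i)) u w := by
  classical
  have hsym : ∀ x y, inner ℝ (Q x) y = inner ℝ x (Q y) := hQ.isSymmetric
  -- `Q² = T₀ T₀*` makes `T₀*` and `Q` induce the same inner products, so identities and limits for
  -- `Q T₁` transfer to `T₀* T₁`.
  have hR : ∀ x y, inner ℝ (adjoint T₀ (T₁ x)) (adjoint T₀ (T₁ y))
      = inner ℝ (Q (T₁ x)) (Q (T₁ y)) := fun x y => by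
    rw [adjoint_inner_right, hsym]
    have h : T₀ (adjoint T₀ (T₁ x)) = Q (Q (T₁ x)) :=
      (congrArg (fun f : L →L[ℝ] L => f (T₁ x)) hQQ).symm
    rw [h, hsym, hsym]
  -- The `fᵢ` are orthogonal with squared norm `lᵢ`; normalized where `lᵢ > 0` they become the right
  -- singular vectors.
  set f : ι → E := fun i => adjoint T₁ (Q (b i)) with hf
  have hQT : ∀ i, Q (T₁ (f i)) = l i • b i := hl
  have hff : ∀ i j, inner ℝ (f i) (f j) = if i = j then l i else 0 := fun i j => by
    change inner ℝ (f i) (adjoint T₁ (Q (b j))) = _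
    rw [adjoint_inner_right, ← hsym, hQT, real_inner_smul_left,
      orthonormal_iff_ite.1 b.orthonormal]
    split_ifs <;> simp
  have hl0 : ∀ i, 0 ≤ l i := fun i => by
    have h := hff i i
    rw [if_pos rfl] at h
    rw [← h]
    exact real_inner_self_nonneg
  have hs : ∀ i : {i // 0 < l i}, 0 < √(l i) := fun i => Real.sqrt_pos.2 i.2
  have hss : ∀ i : {i // 0 < l i}, √(l i) * √(l i) = l i := fun i => Real.mul_self_sqrt i.2.le
  set w : {i // 0 < l i} → E := fun i => (√(l i))⁻¹ • f i with hw
  have hQw : ∀ i, Q (T₁ (w i)) = √(l i) • b i := fun i => by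
    rw [hw]
    simp only [map_smul]
    rw [hQT, smul_smul, inv_mul_eq_div, Real.div_sqrt]
  set u : {i // 0 < l i} → G := fun i => (√(l i))⁻¹ • adjoint T₀ (T₁ (w i)) with hu
  have hRw : ∀ i, adjoint T₀ (T₁ (w i)) = √(l i) • u i := fun i => by
    rw [hu]
    simp only
    rw [smul_inv_smul₀ (hs i).ne']
  refine ⟨hl0, u, w, fun i => (hs i).le, ?_, ?_, hRw, fun x y => ?_⟩
  · rw [orthonormal_iff_ite]
    intro i j
    rw [hu]
    simp only [real_inner_smul_left, real_inner_smul_right]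
    rw [hR, hQw, hQw, real_inner_smul_left, real_inner_smul_right,
      orthonormal_iff_ite.1 b.orthonormal]
    have h1 := (hs i).ne'
    have h2 := (hs j).ne'
    simp only [Subtype.ext_iff]
    split_ifs
    · field_simp
    · simp
  · rw [orthonormal_iff_ite]
    intro i j
    rw [hw]
    simp only [real_inner_smul_left, real_inner_smul_right]
    rw [hff]
    simp only [Subtype.ext_iff]
    split_ifs with h
    · rw [← h, ← mul_assoc, ← mul_inv, hss, inv_mul_cancel₀ i.2.ne']
    · simp
  · have h1 : HasSum (fun i : {i // 0 < l i} => (√(l i) * inner ℝ (w i) x) • b i) (Q (T₁ x)) := by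
      have h := b.hasSum_repr (Q (T₁ x))
      have h2 : ∀ i, b.repr (Q (T₁ x)) i = inner ℝ (f i) x := fun i => by
        rw [b.repr_apply_apply, ← hsym, ← adjoint_inner_left]
      simp only [h2] at h
      have h3 : Function.support (fun i => inner ℝ (f i) x • b i) ⊆ {i | 0 < l i} := fun i hi => by
        by_contra h0
        have h4 : l i = 0 := le_antisymm (not_lt.1 h0) (hl0 i)
        have h5 : f i = 0 := by
          have := hff i i
          rw [if_pos rfl, h4] at this
          exact inner_self_eq_zero.1 this
        simp [h5] at hi
      have h6 := (hasSum_subtype_iff_of_support_subset h3).2 h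
      have h7 : (fun i : {i // 0 < l i} => (√(l i) * inner ℝ (w i) x) • b i)
          = (fun i => inner ℝ (f i) x • b i) ∘ Subtype.val := funext fun i => by
        rw [hw]
        simp only [real_inner_smul_left, Function.comp_apply]
        rw [mul_inv_cancel_left₀ (hs i).ne']
      rw [h7]
      exact h6
    have h2 : HasSum (fun i : {i // 0 < l i} => (√(l i) * inner ℝ (w i) x) • u i)
        (adjoint T₀ (T₁ x)) := by
      -- The partial sums for `T₀* T₁ x` and for `Q T₁ x` have errors of equal norm by `hR`.
      rw [HasSum, tendsto_iff_norm_sub_tendsto_zero] at h1 ⊢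
      refine h1.congr fun I => ?_
      have e1 : ∑ i ∈ I, (√(l i) * inner ℝ (w i) x) • u i - adjoint T₀ (T₁ x)
          = adjoint T₀ (T₁ (∑ i ∈ I, inner ℝ (w i) x • w i - x)) := by
        simp only [map_sub, map_sum, map_smul, hRw, smul_smul, mul_comm]
      have e2 : ∑ i ∈ I, (√(l i) * inner ℝ (w i) x) • b i - Q (T₁ x)
          = Q (T₁ (∑ i ∈ I, inner ℝ (w i) x • w i - x)) := by
        simp only [map_sub, map_sum, map_smul, hQw, smul_smul, mul_comm]
      rw [e1, e2, norm_eq_sqrt_real_inner, norm_eq_sqrt_real_inner, hR]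
    have h3 := h2.mapL (innerSL ℝ y)
    simp only [innerSL_apply_apply, real_inner_smul_right] at h3
    rw [real_inner_comm] at h3
    simp only [real_inner_comm y, mul_assoc] at h3 ⊢
    exact h3

end SVDConstruction

/-! ### Tensor products of feature maps -/

section FeatureTensor

open TensorProduct

variable {X E G : Type*} [TopologicalSpace X] [NormedAddCommGroup E] [InnerProductSpace ℝ E]
  [NormedAddCommGroup G] [InnerProductSpace ℝ G]

/-- The tensor product `φ(x) ⊗ ψ(x)` of two feature maps. -/
def featureTensor (φ : C(X, G)) (ψ : C(X, E)) : C(X, UniformSpace.Completion (G ⊗[ℝ] E)) :=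
  ⟨fun x => ((φ x ⊗ₜ[ℝ] ψ x : G ⊗[ℝ] E) : UniformSpace.Completion (G ⊗[ℝ] E)),
    (UniformSpace.Completion.continuous_coe _).comp
      (TensorProduct.continuous_tmul.comp (φ.continuous.prodMk ψ.continuous))⟩

theorem inner_featureTensor (φ : C(X, G)) (ψ : C(X, E)) (g : G) (e : E) (x : X) :
    inner ℝ ((g ⊗ₜ[ℝ] e : G ⊗[ℝ] E) : UniformSpace.Completion (G ⊗[ℝ] E)) (featureTensor φ ψ x)
      = inner ℝ g (φ x) * inner ℝ e (ψ x) := by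
  change inner ℝ (_ : UniformSpace.Completion (G ⊗[ℝ] E))
    ((φ x ⊗ₜ[ℝ] ψ x : G ⊗[ℝ] E) : UniformSpace.Completion (G ⊗[ℝ] E)) = _
  rw [UniformSpace.Completion.inner_coe, TensorProduct.inner_tmul]

theorem norm_featureTensor (φ : C(X, G)) (ψ : C(X, E)) (x : X) :
    ‖featureTensor φ ψ x‖ = ‖φ x‖ * ‖ψ x‖ := by
  change ‖((φ x ⊗ₜ[ℝ] ψ x : G ⊗[ℝ] E) : UniformSpace.Completion (G ⊗[ℝ] E))‖ = _
  rw [UniformSpace.Completion.norm_coe, TensorProduct.norm_tmul]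

end FeatureTensor

/-! ### Covariance operators through feature maps -/

section Feature

open TensorProduct ContinuousLinearMap

variable {X : Type*} [TopologicalSpace X] [CompactSpace X] [MeasurableSpace X] [BorelSpace X]

/-- Arzelà-Ascoli: since `x ↦ K(x, ·)` is continuous into `L²`, the unit ball is mapped to a bounded
equicontinuous set of continuous functions. -/
theorem isCompactOperator_covOp (ρ : Measure X) [IsFiniteMeasure ρ] (K : C(X × X, ℝ)) :
    IsCompactOperator (covOp ρ K) := by
  let A : Set (BoundedContinuousFunction X ℝ) :=
    (fun φ : Lp ℝ 2 ρ => BoundedContinuousFunction.mkOfCompact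
      ⟨fun x => ∫ s, K (x, s) * φ s ∂ρ, continuous_integral_kernel ρ K φ⟩) '' Metric.closedBall 0 1
  have hcont : Continuous fun x => ContinuousMap.toLp 2 ρ ℝ (K.curry x) := by fun_prop
  have hA : IsCompact (closure A) := by
    refine BoundedContinuousFunction.arzela_ascoli (Metric.closedBall 0
      (‖(ContinuousMap.toLp 2 ρ ℝ : C(X, ℝ) →L[ℝ] Lp ℝ 2 ρ)‖ * ‖K.curry‖))
      (isCompact_closedBall _ _) A ?_ ?_
    · rintro _ x ⟨φ, hφ, rfl⟩
      rw [mem_closedBall_zero_iff] at hφ ⊢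
      change ‖∫ s, K (x, s) * φ s ∂ρ‖ ≤ _
      rw [integral_kernel_eq_inner]
      refine (norm_inner_le_norm _ _).trans ?_
      refine (mul_le_of_le_one_right (norm_nonneg _) hφ).trans ?_
      refine (ContinuousLinearMap.le_opNorm
        (ContinuousMap.toLp 2 ρ ℝ : C(X, ℝ) →L[ℝ] Lp ℝ 2 ρ) _).trans ?_
      exact mul_le_mul_of_nonneg_left (K.curry.norm_coe_le_norm x) (norm_nonneg _)
    · intro x₀
      rw [Metric.equicontinuousAt_iff_right]
      intro ε hε
      filter_upwards [Metric.continuousAt_iff'.1 hcont.continuousAt ε hε] with x hx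
      rintro ⟨_, φ, hφ, rfl⟩
      rw [mem_closedBall_zero_iff] at hφ
      change dist (∫ s, K (x₀, s) * φ s ∂ρ) (∫ s, K (x, s) * φ s ∂ρ) < ε
      rw [integral_kernel_eq_inner, integral_kernel_eq_inner, dist_comm, dist_eq_norm, ← inner_sub_left]
      refine (norm_inner_le_norm _ _).trans_lt ?_
      refine (mul_le_of_le_one_right (norm_nonneg _) hφ).trans_lt ?_
      rwa [← dist_eq_norm]
  refine (isCompactOperator_iff_image_closedBall_subset_compact
    (covOp ρ K : Lp ℝ 2 ρ →ₗ[ℝ] Lp ℝ 2 ρ) zero_lt_one).2 ⟨(fun g : BoundedContinuousFunction X ℝ => ContinuousMap.toLp 2 ρ ℝ g.toContinuousMap)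
    '' closure A, hA.image ?_, ?_⟩
  · refine (ContinuousMap.toLp 2 ρ ℝ).continuous.comp ?_
    exact (ContinuousMap.isometryEquivBoundedOfCompact X ℝ).symm.continuous
  · rintro _ ⟨φ, hφ, rfl⟩
    exact ⟨_, subset_closure ⟨φ, hφ, rfl⟩, rfl⟩

variable {E G : Type*} [NormedAddCommGroup E] [InnerProductSpace ℝ E]
  [NormedAddCommGroup G] [InnerProductSpace ℝ G]

/-- The operator `g ↦ ⟪g, φ(·)⟫` from a feature space to `L²`. -/
def featureOp (ρ : Measure X) [IsFiniteMeasure ρ] (φ : C(X, G)) : G →L[ℝ] Lp ℝ 2 ρ :=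
  (ContinuousMap.toLp 2 ρ ℝ) ∘L LinearMap.mkContinuous
    { toFun := fun g => ⟨fun x => inner ℝ g (φ x), by fun_prop⟩
      map_add' := fun g h => ContinuousMap.ext fun x => inner_add_left _ _ _
      map_smul' := fun c g => ContinuousMap.ext fun x => real_inner_smul_left _ _ _ } ‖φ‖
    (fun g => by
      rw [ContinuousMap.norm_le _ (by positivity)]
      intro x
      refine (norm_inner_le_norm _ _).trans ?_
      rw [mul_comm]
      exact mul_le_mul_of_nonneg_right (φ.norm_coe_le_norm x) (norm_nonneg _))

theorem coeFn_featureOp (ρ : Measure X) [IsFiniteMeasure ρ] (φ : C(X, G)) (g : G) :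
    featureOp ρ φ g =ᵐ[ρ] fun x => inner ℝ g (φ x) :=
  ContinuousMap.coeFn_toLp (p := 2) (𝕜 := ℝ) ρ _

theorem inner_featureOp (ρ : Measure X) [IsFiniteMeasure ρ] (φ : C(X, G)) (ψ : C(X, E)) (g : G)
    (e : E) :
    inner ℝ (featureOp ρ φ g) (featureOp ρ ψ e) = ∫ x, inner ℝ g (φ x) * inner ℝ e (ψ x) ∂ρ := by
  rw [L2.inner_def]
  refine integral_congr_ae ?_
  filter_upwards [coeFn_featureOp ρ φ g, coeFn_featureOp ρ ψ e] with x h1 h2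
  rw [h1, h2, real_inner_comm]
  rfl

variable [CompleteSpace G]

theorem covOp_eq_comp_adjoint (ρ : Measure X) [IsFiniteMeasure ρ] {K : C(X × X, ℝ)} {φ : C(X, G)}
    (hφ : ∀ x y, inner ℝ (φ x) (φ y) = K (x, y)) :
    covOp ρ K = featureOp ρ φ ∘L adjoint (featureOp ρ φ) := by
  ext1 f
  change ContinuousMap.toLp 2 ρ ℝ _ = ContinuousMap.toLp 2 ρ ℝ _
  congr 1
  ext x
  change ∫ s, K (x, s) * f s ∂ρ = inner ℝ (adjoint (featureOp ρ φ) f) (φ x)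
  rw [adjoint_inner_left, L2.inner_def]
  refine integral_congr_ae ?_
  filter_upwards [coeFn_featureOp ρ φ (φ x)] with s h1
  rw [h1, hφ]
  rfl

/-- The population cross operator is the expectation of the random tensor `φ(x) ⊗ ψ(x)`, whose
empirical mean appears in `represents_sampleOp`. -/
theorem represents_featureOp [CompleteSpace E] [SecondCountableTopology X] (ρ : Measure X) [IsFiniteMeasure ρ]
    (φ : C(X, G)) (ψ : C(X, E)) :
    Represents (∫ x, featureTensor φ ψ x ∂ρ) (adjoint (featureOp ρ φ) ∘L featureOp ρ ψ) := by
  intro g e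
  have hint : Integrable (featureTensor φ ψ) ρ :=
    (featureTensor φ ψ).continuous.integrable_of_hasCompactSupport (HasCompactSupport.of_compactSpace _)
  rw [← integral_inner hint]
  simp only [inner_featureTensor]
  rw [comp_apply, adjoint_inner_right, inner_featureOp]

theorem exists_isPositive_sqrt_covOp {ρ : Measure X} [IsFiniteMeasure ρ] {K : C(X × X, ℝ)}
    {φ : C(X, G)} (hφ : ∀ x y, inner ℝ (φ x) (φ y) = K (x, y)) :
    ∃ B : Lp ℝ 2 ρ →L[ℝ] Lp ℝ 2 ρ, B.IsPositive ∧ B * B = covOp ρ K := by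
  have hpos : (covOp ρ K).IsPositive := by
    rw [covOp_eq_comp_adjoint ρ hφ]
    exact isPositive_self_comp_adjoint _
  obtain ⟨ι, b, l, hl⟩ := exists_hilbertBasis_eigenvectors (isCompactOperator_covOp ρ K)
    hpos.isSymmetric
  refine exists_isPositive_sqrt b hl fun i => ?_
  have h := hpos.inner_nonneg_left (b i)
  rwa [hl, real_inner_smul_left, real_inner_self_eq_norm_sq, b.orthonormal.1, one_pow, mul_one] at h

variable [CompleteSpace E]

theorem tsum_entropyFun_subtype {ι : Type*} {l : ι → ℝ} (hl : ∀ i, 0 ≤ l i) (a : ℝ) :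
    ∑' i : {i // 0 < l i}, entropyFun (a * √(l i)) = ∑' i, entropyFun (a * √(l i)) := by
  refine tsum_subtype_eq_of_support_subset (s := {i | 0 < l i})
    (f := fun i => entropyFun (a * √(l i))) fun i hi => ?_
  by_contra h0
  have h4 : l i = 0 := le_antisymm (not_lt.1 h0) (hl i)
  simp [h4, entropyFun] at hi

/-- The singular values of the cross operator between the feature spaces determine the entropic part of
the regularized distance between covariance operators. -/
theorem exists_isSVD_opW2.{u} {X : Type u} [TopologicalSpace X] [CompactSpace X]
    [MeasurableSpace X] [BorelSpace X] [SecondCountableTopology X] (ρ : Measure X)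
    [IsFiniteMeasure ρ] {K₀ K₁ : C(X × X, ℝ)} {φ : C(X, G)} {ψ : C(X, E)}
    (hφ : ∀ x y, inner ℝ (φ x) (φ y) = K₀ (x, y)) (hψ : ∀ x y, inner ℝ (ψ x) (ψ y) = K₁ (x, y))
    (ε : ℝ) :
    ∃ (ι : Type u) (s : ι → ℝ) (u : ι → G) (w : ι → E),
      IsSVD (adjoint (featureOp ρ φ) ∘L featureOp ρ ψ) s u w ∧
      opW2 ε (covOp ρ K₀) (covOp ρ K₁) = opTrace (covOp ρ K₀) + opTrace (covOp ρ K₁)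
        - ε / 2 * ∑' i, entropyFun (4 / ε * s i) := by
  obtain ⟨hQ, hQQ⟩ := opSqrt_spec (exists_isPositive_sqrt_covOp (ρ := ρ) hφ)
  set Q := opSqrt (covOp ρ K₀) with hQdef
  have hcomp : IsCompactOperator (Q * covOp ρ K₁ * Q) :=
    ((isCompactOperator_covOp ρ K₁).comp_clm Q).clm_comp Q
  have hB := covOp_eq_comp_adjoint ρ hψ
  have hsym : ((Q * covOp ρ K₁ * Q : Lp ℝ 2 ρ →L[ℝ] Lp ℝ 2 ρ) :
      Lp ℝ 2 ρ →ₗ[ℝ] Lp ℝ 2 ρ).IsSymmetric := fun x y => by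
    have h1 : (covOp ρ K₁).IsPositive := by
      rw [hB]
      exact isPositive_self_comp_adjoint _
    change inner ℝ (Q (covOp ρ K₁ (Q x))) y = inner ℝ x (Q (covOp ρ K₁ (Q y)))
    rw [hQ.inner_left_eq_inner_right, h1.inner_left_eq_inner_right, hQ.inner_left_eq_inner_right]
  obtain ⟨ι, b, l, hl⟩ := exists_hilbertBasis_eigenvectors hcomp hsym
  rw [covOp_eq_comp_adjoint ρ hφ] at hQQ
  have hl' := hl
  rw [hB] at hl'
  obtain ⟨hl0, u, w, hsvd⟩ := exists_isSVD hQ hQQ hl'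
  refine ⟨_, _, u, w, hsvd, ?_⟩
  -- The `lᵢ` are the squared singular values of the cross operator, so its Hilbert-Schmidt bound
  -- makes them summable.
  have hsum : Summable l := by
    have h := hsvd.summable_sq (represents_featureOp ρ φ ψ)
    have h2 : Summable fun i : {i // 0 < l i} => l i := by
      simpa only [Real.sq_sqrt (hl0 _)] using h
    exact ((hasSum_subtype_iff_of_support_subset (s := {i | 0 < l i}) fun i hi =>
      lt_of_le_of_ne (hl0 i) (Ne.symm hi)).1 h2.hasSum).summable
  rw [opW2_of_diagonal hl hl0 hsum, tsum_entropyFun_subtype hl0]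

end Feature

/-! ### Uniqueness of the principal matrix square root -/

section Sylvester

open Polynomial

theorem aeval_mul_eq_mul_aeval {A : Type*} [Ring A] [Algebra ℂ A] {B C X : A} (h : B * X = X * C)
    (p : ℂ[X]) : aeval B p * X = X * aeval C p := by
  induction p using Polynomial.induction_on' with
  | add p q hp hq => rw [map_add, map_add, add_mul, mul_add, hp, hq]
  | monomial k a =>
    have hk : ∀ k : ℕ, B ^ k * X = X * C ^ k := fun k => by
      induction k with
      | zero => simp
      | succ k ih => rw [pow_succ, mul_assoc, h, ← mul_assoc, ih, mul_assoc, ← pow_succ]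
    rw [aeval_monomial, aeval_monomial, mul_assoc, hk, ← mul_assoc, ← mul_assoc,
      Algebra.commutes]

variable {n : ℕ}

/-- The principal square root of a matrix is unique. -/
theorem eq_of_mul_self_eq_mul_self {B C : Matrix (Fin n) (Fin n) ℂ} (h : B * B = C * C)
    (hB : ∀ z ∈ spectrum ℂ B, 0 < z.re) (hC : ∀ z ∈ spectrum ℂ C, 0 < z.re) : B = C := by
  rcases isEmpty_or_nonempty (Fin n) with hn | hn
  · exact Matrix.ext fun i => hn.elim i
  -- A Sylvester equation for `B - C`. The characteristic polynomial of `B` kills `B` but is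
  -- invertible at `-C`, as the spectra of `B` and `-C` lie in opposite half-planes.
  have h1 : B * (B - C) = (B - C) * -C := by
    rw [mul_sub, sub_mul, mul_neg, mul_neg, h]
    abel
  have h2 := aeval_mul_eq_mul_aeval h1 B.charpoly
  rw [Matrix.aeval_self_charpoly, zero_mul] at h2
  have hu : IsUnit (aeval (-C) B.charpoly) := by
    by_contra hnu
    rw [← spectrum.zero_mem_iff ℂ, spectrum.map_polynomial_aeval_of_nonempty _ _
      (spectrum.nonempty_of_isAlgClosed_of_finiteDimensional ℂ _)] at hnu
    obtain ⟨z, hz, hz0⟩ := hnu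
    have h3 := hB z (Matrix.mem_spectrum_iff_isRoot_charpoly.2 hz0)
    rw [← spectrum.neg_eq, Set.mem_neg] at hz
    have h4 := hC _ hz
    rw [Complex.neg_re] at h4
    linarith
  exact sub_eq_zero.1 ((hu.mul_left_eq_zero).1 h2.symm)

theorem matSqrt_eq {A B : Matrix (Fin n) (Fin n) ℝ} (hA : B * B = A)
    (hB : ∀ z ∈ spectrum ℂ (B.map (algebraMap ℝ ℂ)), 0 < z.re) : matSqrt A = B := by
  have h : ∃ B : Matrix (Fin n) (Fin n) ℝ,
      B * B = A ∧ ∀ z ∈ spectrum ℂ (B.map (algebraMap ℝ ℂ)), 0 < z.re := ⟨B, hA, hB⟩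
  rw [matSqrt, dif_pos h]
  have h2 : h.choose.map (algebraMap ℝ ℂ) = B.map (algebraMap ℝ ℂ) := by
    refine eq_of_mul_self_eq_mul_self ?_ h.choose_spec.2 hB
    rw [← Matrix.map_mul, ← Matrix.map_mul, h.choose_spec.1, hA]
  exact Matrix.map_injective (algebraMap ℝ ℂ).injective h2

end Sylvester

/-! ### Evaluating `matF` on a product of Gram matrices -/

section SpectralMatrix

open Matrix

variable {n : ℕ}

theorem exists_diagonalization {A : Matrix (Fin n) (Fin n) ℝ} (hA : A.IsHermitian) :
    ∃ U : Matrix (Fin n) (Fin n) ℝ, Uᴴ * U = 1 ∧ U * Uᴴ = 1 ∧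
      A = U * diagonal hA.eigenvalues * Uᴴ := by
  refine ⟨hA.eigenvectorUnitary, ?_, ?_, ?_⟩
  · exact Unitary.coe_star_mul_self hA.eigenvectorUnitary
  · exact Unitary.coe_mul_star_self hA.eigenvectorUnitary
  · conv_lhs => rw [hA.spectral_theorem]
    rfl

theorem exists_posSemidef_sqrt {A : Matrix (Fin n) (Fin n) ℝ} (hA : A.PosSemidef) :
    ∃ P : Matrix (Fin n) (Fin n) ℝ, P.PosSemidef ∧ P * P = A := by
  obtain ⟨U, h1, -, h3⟩ := exists_diagonalization hA.1
  refine ⟨U * diagonal (fun i => √(hA.1.eigenvalues i)) * Uᴴ, ?_, ?_⟩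
  · exact (PosSemidef.diagonal fun i => Real.sqrt_nonneg _).mul_mul_conjTranspose_same U
  · conv_rhs => rw [h3]
    calc _ = U * diagonal (fun i => √(hA.1.eigenvalues i)) * (Uᴴ * U)
          * diagonal (fun i => √(hA.1.eigenvalues i)) * Uᴴ := by simp only [Matrix.mul_assoc]
      _ = _ := by
        rw [h1, Matrix.mul_one, Matrix.mul_assoc U, diagonal_mul_diagonal]
        simp only [Real.mul_self_sqrt (hA.eigenvalues_nonneg _)]

/-- `A B` need not be symmetric, and `P` need not be invertible, so conjugating to `S = P B P` is
unavailable. Instead the root of `1 + c A B` is written as `1 + P g(S) P B`, and cyclicity reduces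
its trace, determinant and spectrum to those of functions of `S`. -/
theorem matF_smul_mul {A B P : Matrix (Fin n) (Fin n) ℝ} (hPA : P * P = A)
    (hS : (P * B * P).PosSemidef) {c : ℝ} (hc : 0 ≤ c) :
    matF (c • (A * B)) = ∑ i, entropyFun (√c * √(hS.1.eigenvalues i)) := by
  obtain ⟨U, h1, h2, h3⟩ := exists_diagonalization hS.1
  set l := hS.1.eigenvalues with hl
  have hl0 : ∀ i, 0 ≤ l i := hS.eigenvalues_nonneg
  set r : Fin n → ℝ := fun i => √(1 + c * l i) with hr
  have hr1 : ∀ i, 1 ≤ r i := fun i =>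
    Real.one_le_sqrt.2 (le_add_of_nonneg_right (mul_nonneg hc (hl0 i)))
  have hr2 : ∀ i, r i * r i = 1 + c * l i := fun i =>
    Real.mul_self_sqrt (by have := mul_nonneg hc (hl0 i); linarith)
  set D : (Fin n → ℝ) → Matrix (Fin n) (Fin n) ℝ := fun f => U * diagonal f * Uᴴ with hD
  have hDmul : ∀ f g, D f * D g = D (f * g) := fun f g => by
    calc _ = U * diagonal f * (Uᴴ * U) * diagonal g * Uᴴ := by simp only [hD, Matrix.mul_assoc]
      _ = _ := by
        rw [h1, Matrix.mul_one, Matrix.mul_assoc U, diagonal_mul_diagonal]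
        rfl
  have hDtr : ∀ f, (D f).trace = ∑ i, f i := fun f => by
    rw [hD]
    simp only
    rw [Matrix.mul_assoc, trace_mul_comm, Matrix.mul_assoc, h1, Matrix.mul_one, trace_diagonal]
  have hDdet : ∀ f, (1 + D f).det = ∏ i, (1 + f i) := fun f => by
    rw [hD]
    simp only
    rw [Matrix.mul_assoc, det_one_add_mul_comm, Matrix.mul_assoc, h1, Matrix.mul_one,
      ← diagonal_one, diagonal_add, det_diagonal]
  have hDchar : ∀ f, (D f).charpoly = ∏ i, (Polynomial.X - Polynomial.C (f i)) := fun f => by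
    rw [hD]
    simp only
    rw [Matrix.mul_assoc, charpoly_mul_comm, Matrix.mul_assoc, h1, Matrix.mul_one,
      charpoly_diagonal]
  have hDadd : ∀ f g, D f + D g = D (f + g) := fun f g => by
    simp only [hD]
    rw [← Matrix.add_mul, ← Matrix.mul_add, diagonal_add]
    rfl
  have hDone : D 1 = 1 := by
    simp only [hD]
    rw [Pi.one_def, diagonal_one, Matrix.mul_one, h2]
  have hDS : D l = P * B * P := h3.symm
  -- This is `(√(1 + c l) - 1) / l` in a form that makes sense at `l = 0`. It solves `2g + l g² =
  -- c`, which is what squaring `1 + N` requires.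
  set g : Fin n → ℝ := fun i => c / (1 + r i) with hg
  have hgl : g * l = r - 1 := funext fun i => by
    have := hr1 i
    have := hr2 i
    simp only [hg, Pi.mul_apply, Pi.sub_apply, Pi.one_apply]
    field_simp
    linarith
  have hcg : g + g + g * l * g = fun _ => c := funext fun i => by
    have h4 := hr1 i
    have h5 : g i * (1 + r i) = c := div_mul_cancel₀ _ (by linarith)
    have h6 : g i * l i = r i - 1 := congrFun hgl i
    simp only [Pi.mul_apply, Pi.add_apply]
    rw [h6]
    linarith
  have hDc : D (fun _ => c) = c • 1 := by
    rw [← hDone]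
    simp only [hD]
    rw [← Matrix.smul_mul, ← Matrix.mul_smul, ← diagonal_smul]
    congr 3
    funext i
    simp
  set N := P * (D g * (P * B)) with hN
  have hNcomm : D g * (P * B) * P = D (r - 1) := by
    rw [Matrix.mul_assoc, ← hDS, hDmul, hgl]
  have hNsq : (1 + N) * (1 + N) = 1 + c • (A * B) := by
    have e1 : N * N = P * D (g * l * g) * (P * B) := by
      calc _ = P * (D g * (P * B * P) * D g) * (P * B) := by simp only [hN, Matrix.mul_assoc]
        _ = _ := by rw [← hDS, hDmul, hDmul]
    have e2 : N = P * D g * (P * B) := by simp only [hN, Matrix.mul_assoc]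
    calc _ = 1 + (N + N + N * N) := by noncomm_ring
      _ = 1 + P * D (g + g + g * l * g) * (P * B) := by
        rw [e1, e2, ← hDadd, ← hDadd, Matrix.mul_add, Matrix.mul_add, Matrix.add_mul,
          Matrix.add_mul]
      _ = _ := by
        rw [hcg, hDc, Matrix.mul_smul, Matrix.mul_one, Matrix.smul_mul, ← Matrix.mul_assoc, hPA]
  have hspec : ∀ z ∈ spectrum ℂ ((1 + N).map (algebraMap ℝ ℂ)), 0 < z.re := fun z hz => by
    have hz' : z - 1 ∈ spectrum ℂ (N.map (algebraMap ℝ ℂ)) := by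
      rw [spectrum.mem_iff] at hz ⊢
      rw [Matrix.map_add _ (map_add _), Matrix.map_one _ (map_zero _) (map_one _)] at hz
      rwa [map_sub, map_one, sub_sub]
    rw [mem_spectrum_iff_isRoot_charpoly, charpoly_map, hN, charpoly_mul_comm, hNcomm, hDchar,
      Polynomial.IsRoot, Polynomial.map_prod, Polynomial.eval_prod, Finset.prod_eq_zero_iff] at hz'
    obtain ⟨i, -, hi⟩ := hz'
    have hi' : z - 1 - ((r i - 1 : ℝ) : ℂ) = 0 := by simpa using hi
    have : z = (r i : ℂ) := by
      push_cast at hi'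
      linear_combination hi'
    rw [this, Complex.ofReal_re]
    linarith [hr1 i]
  have hdet : ((1 / 2 : ℝ) • (1 : Matrix (Fin n) (Fin n) ℝ) + (1 / 2 : ℝ) • (1 + N)).det
      = ∏ i, (1 + r i) / 2 := by
    have e : (1 / 2 : ℝ) • (1 : Matrix (Fin n) (Fin n) ℝ) + (1 / 2 : ℝ) • (1 + N)
        = 1 + P * ((1 / 2 : ℝ) • (D g * (P * B))) := by
      rw [Matrix.mul_smul, ← hN, smul_add, ← add_assoc, ← add_smul]
      norm_num
    have e2 : (1 / 2 : ℝ) • D (r - 1) = D ((1 / 2 : ℝ) • (r - 1)) := by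
      simp only [hD]
      rw [← Matrix.smul_mul, ← Matrix.mul_smul, ← diagonal_smul]
    rw [e, det_one_add_mul_comm, Matrix.smul_mul, hNcomm, e2, hDdet]
    refine Finset.prod_congr rfl fun i _ => ?_
    simp only [Pi.smul_apply, Pi.sub_apply, Pi.one_apply, smul_eq_mul]
    ring
  rw [matF, matSqrt_eq hNsq hspec, hdet, neg_add_cancel_left, hN, trace_mul_comm, hNcomm, hDtr,
    Real.log_prod fun i _ => by have := hr1 i; positivity, ← Finset.sum_sub_distrib]
  refine Finset.sum_congr rfl fun i _ => ?_
  rw [entropyFun, mul_pow, Real.sq_sqrt hc, Real.sq_sqrt (hl0 i)]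
  rfl

end SpectralMatrix

/-! ### Gram matrices through sampled feature maps -/

section Sampling

open ContinuousLinearMap TensorProduct

variable {X E G : Type*} [NormedAddCommGroup E] [InnerProductSpace ℝ E]
  [NormedAddCommGroup G] [InnerProductSpace ℝ G] {n : ℕ}

/-- The operator `g ↦ n^{-1/2} (⟪g, φ(x₁)⟫, …, ⟪g, φ(xₙ)⟫)` from a feature space to `ℝⁿ`. -/
def sampleOp (φ : X → G) (x : Fin n → X) : G →L[ℝ] EuclideanSpace ℝ (Fin n) :=
  ((EuclideanSpace.equiv (Fin n) ℝ).symm : (Fin n → ℝ) →L[ℝ] EuclideanSpace ℝ (Fin n)) ∘L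
    ContinuousLinearMap.pi fun j => (√(n : ℝ))⁻¹ • (innerSL ℝ (φ (x j)) : G →L[ℝ] ℝ)

theorem sampleOp_apply (φ : X → G) (x : Fin n → X) (g : G) (j : Fin n) :
    sampleOp φ x g j = (√(n : ℝ))⁻¹ * inner ℝ (φ (x j)) g := rfl

theorem sampleOp_scale (n : ℕ) : (√(n : ℝ))⁻¹ * (√(n : ℝ))⁻¹ = (n : ℝ)⁻¹ := by
  rw [← mul_inv, Real.mul_self_sqrt n.cast_nonneg]

theorem inner_sampleOp (φ : X → G) (ψ : X → E) (x : Fin n → X) (g : G) (e : E) :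
    inner ℝ (sampleOp φ x g) (sampleOp ψ x e)
      = (n : ℝ)⁻¹ * ∑ j, inner ℝ g (φ (x j)) * inner ℝ e (ψ (x j)) := by
  rw [PiLp.inner_apply, Finset.mul_sum]
  refine Finset.sum_congr rfl fun j _ => ?_
  rw [sampleOp_apply, sampleOp_apply, ← sampleOp_scale, real_inner_comm g, real_inner_comm e]
  simp
  ring

variable [CompleteSpace G]

theorem sampleOp_comp_adjoint {K : X × X → ℝ} {φ : X → G}
    (hφ : ∀ x y, inner ℝ (φ x) (φ y) = K (x, y)) (x : Fin n → X) :
    sampleOp φ x ∘L adjoint (sampleOp φ x) = Matrix.toEuclideanCLM (𝕜 := ℝ) (gramMat K x) := by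
  ext y j
  have h : sampleOp φ x (adjoint (sampleOp φ x) y) j
      = ∑ k, (√(n : ℝ))⁻¹ * ((√(n : ℝ))⁻¹ * K (x j, x k)) * y k := by
    rw [sampleOp_apply, adjoint_inner_right, PiLp.inner_apply, Finset.mul_sum]
    refine Finset.sum_congr rfl fun k _ => ?_
    rw [sampleOp_apply, real_inner_comm (φ (x j)), hφ]
    simp
    ring
  refine h.trans ?_
  rw [Matrix.ofLp_toEuclideanCLM, Matrix.mulVec, dotProduct]
  refine Finset.sum_congr rfl fun k _ => ?_
  rw [gramMat, Matrix.of_apply, ← mul_assoc, sampleOp_scale, one_div]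

theorem represents_sampleOp [TopologicalSpace X] [CompleteSpace E] (φ : C(X, G)) (ψ : C(X, E)) (x : Fin n → X) :
    Represents ((n : ℝ)⁻¹ • ∑ j, featureTensor φ ψ (x j))
      (adjoint (sampleOp φ x) ∘L sampleOp ψ x) := by
  intro g e
  rw [real_inner_smul_right, inner_sum, comp_apply, adjoint_inner_right, inner_sampleOp]
  simp only [inner_featureTensor]

theorem gramMat_posSemidef {K : X × X → ℝ} (hK : (Matrix.of fun x y => K (x, y)).PosSemidef)
    (x : Fin n → X) : (gramMat K x).PosSemidef :=
  (hK.submatrix x).smul (show (0 : ℝ) ≤ 1 / (n : ℝ) by positivity)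

/-- The construction `exists_isSVD` again, now with `ℝⁿ` in place of `L²`; the cross operator still
acts between the feature spaces, independently of `n`. -/
theorem exists_isSVD_empW2 [CompleteSpace E] {K₀ K₁ : X × X → ℝ}
    (hK₀ : (Matrix.of fun x y => K₀ (x, y)).PosSemidef)
    (hK₁ : (Matrix.of fun x y => K₁ (x, y)).PosSemidef) {φ : X → G} {ψ : X → E}
    (hφ : ∀ x y, inner ℝ (φ x) (φ y) = K₀ (x, y)) (hψ : ∀ x y, inner ℝ (ψ x) (ψ y) = K₁ (x, y))
    {ε : ℝ} (hε : 0 < ε) (x : Fin n → X) :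
    ∃ (ι : Type) (s : ι → ℝ) (u : ι → G) (w : ι → E),
      IsSVD (adjoint (sampleOp φ x) ∘L sampleOp ψ x) s u w ∧
      empW2 ε K₀ K₁ x = (gramMat K₀ x + gramMat K₁ x).trace
        - ε / 2 * ∑' i, entropyFun (4 / ε * s i) := by
  obtain ⟨P, hP, hPP⟩ := exists_posSemidef_sqrt (gramMat_posSemidef hK₀ x)
  have hS : (P * gramMat K₁ x * P).PosSemidef := by
    have h := (gramMat_posSemidef hK₁ x).mul_mul_conjTranspose_same P
    rwa [hP.1.eq] at h
  set T := Matrix.toEuclideanCLM (n := Fin n) (𝕜 := ℝ) with hT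
  have hQ : (T P).IsPositive := by
    rw [← ContinuousLinearMap.isPositive_toLinearMap_iff]
    exact Matrix.isPositive_toEuclideanLin_iff.2 hP
  have hQQ : T P * T P = sampleOp φ x ∘L adjoint (sampleOp φ x) := by
    rw [sampleOp_comp_adjoint hφ, ← map_mul, hPP]
  have hdiag : ∀ i, (T P * (sampleOp ψ x ∘L adjoint (sampleOp ψ x)) * T P)
      (hS.1.eigenvectorBasis.toHilbertBasis i)
        = hS.1.eigenvalues i • hS.1.eigenvectorBasis.toHilbertBasis i := fun i => by
    rw [sampleOp_comp_adjoint hψ, ← map_mul, ← map_mul, OrthonormalBasis.coe_toHilbertBasis]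
    refine (WithLp.ofLp_injective 2) ?_
    rw [Matrix.ofLp_toEuclideanCLM]
    exact hS.1.mulVec_eigenvectorBasis i
  obtain ⟨hl0, u, w, hsvd⟩ := exists_isSVD hQ hQQ hdiag
  refine ⟨_, _, u, w, hsvd, ?_⟩
  rw [empW2, matF_smul_mul hPP hS (by positivity), tsum_entropyFun_subtype hl0, tsum_fintype]
  have h : √(16 / ε ^ 2) = 4 / ε := by
    rw [show 16 / ε ^ 2 = (4 / ε) ^ 2 by rw [div_pow]; norm_num, Real.sqrt_sq (by positivity)]
  rw [h]

end Sampling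

/-! ### McDiarmid's inequality -/

section McDiarmid

variable {X : Type*} [MeasurableSpace X]

theorem measurable_cons {n : ℕ} :
    Measurable fun p : X × (Fin n → X) => (Fin.cons p.1 p.2 : Fin (n + 1) → X) := by
  refine measurable_pi_iff.2 fun i => ?_
  refine Fin.cases ?_ (fun j => ?_) i
  · exact measurable_fst
  · exact (measurable_pi_apply j).comp measurable_snd

variable (μ : Measure X) [IsProbabilityMeasure μ]

theorem integrable_of_measurable_bounded {Y : Type*} [MeasurableSpace Y] (ν : Measure Y)
    [IsFiniteMeasure ν] {f : Y → ℝ} (hf : Measurable f) {C : ℝ} (hC : ∀ y, |f y| ≤ C) :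
    Integrable f ν :=
  Integrable.of_bound hf.aestronglyMeasurable C (Filter.Eventually.of_forall hC)

theorem integral_pi_succ {n : ℕ} {f : (Fin (n + 1) → X) → ℝ} (hf : Measurable f) {C : ℝ}
    (hC : ∀ x, |f x| ≤ C) :
    ∫ x, f x ∂Measure.pi (fun _ => μ)
      = ∫ a, ∫ y, f (Fin.cons a y) ∂Measure.pi (fun _ : Fin n => μ) ∂μ := by
  have h := (measurePreserving_piFinSuccAbove (fun _ : Fin (n + 1) => μ) 0).symm
  rw [← h.integral_comp']
  have e : ∀ p : X × (Fin n → X), (MeasurableEquiv.piFinSuccAbove (fun _ : Fin (n + 1) => X) 0).symm p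
      = Fin.cons p.1 p.2 := fun p => by
    rw [MeasurableEquiv.piFinSuccAbove_symm_apply, Fin.insertNthEquiv_zero]
    rfl
  simp only [e]
  exact integral_prod _ (integrable_of_measurable_bounded _ (hf.comp measurable_cons) fun p => hC _)

theorem measurable_integral_cons {n : ℕ} {f : (Fin (n + 1) → X) → ℝ} (hf : Measurable f) :
    Measurable fun a => ∫ y, f (Fin.cons a y) ∂Measure.pi (fun _ : Fin n => μ) :=
  ((hf.comp measurable_cons).stronglyMeasurable.integral_prod_right' (f := fun p => f (Fin.cons p.1 p.2))).measurable

theorem abs_integral_le_of_bounded {Y : Type*} [MeasurableSpace Y] (ν : Measure Y)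
    [IsProbabilityMeasure ν] {f : Y → ℝ} {C : ℝ} (hC : ∀ y, |f y| ≤ C) : |∫ y, f y ∂ν| ≤ C := by
  have h := norm_integral_le_of_norm_le_const (μ := ν) (f := f) (Filter.Eventually.of_forall hC)
  simpa using h

theorem exp_le_exp_of_abs_le {s t C : ℝ} (hs : |s| ≤ C) : |Real.exp (t * s)| ≤ Real.exp (|t| * C) := by
  rw [abs_of_pos (Real.exp_pos _), Real.exp_le_exp]
  refine (le_abs_self _).trans ?_
  rw [abs_mul]
  exact mul_le_mul_of_nonneg_left hs (abs_nonneg _)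

/-- The exponential moment bound behind McDiarmid's inequality. -/
theorem integral_exp_le_of_boundedDifferences {c : ℝ} :
    ∀ (n : ℕ) {f : (Fin n → X) → ℝ} {C : ℝ}, Measurable f → (∀ x, |f x| ≤ C) →
      (∀ x i a, |f (Function.update x i a) - f x| ≤ c) → ∀ t : ℝ,
      ∫ x, Real.exp (t * (f x - ∫ y, f y ∂Measure.pi (fun _ => μ))) ∂Measure.pi (fun _ => μ)
        ≤ Real.exp (n * c ^ 2 * t ^ 2 / 2)
  | 0, f, C, _, _, _, t => by
    have h : ∀ x, f x = f default := fun x => congrArg f (Subsingleton.elim _ _)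
    simp [h]
  | n + 1, f, C, hf, hC, hc, t => by
    obtain ⟨z⟩ : Nonempty X := Measure.nonempty_of_neZero μ
    -- Conditional mean given the first coordinate: the induction hypothesis handles `f - g`, and
    -- Hoeffding's lemma handles `g - m`.
    set g : X → ℝ := fun a => ∫ y, f (Fin.cons a y) ∂Measure.pi (fun _ : Fin n => μ) with hg
    have hgm : Measurable g := measurable_integral_cons μ hf
    have hfa : ∀ a, Measurable fun y : Fin n → X => f (Fin.cons a y) := fun a =>
      (hf.comp measurable_cons).comp (measurable_const.prodMk measurable_id)
    have hgC : ∀ a, |g a| ≤ C := fun a => abs_integral_le_of_bounded _ fun y => hC _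
    have hfi : ∀ a, Integrable (fun y : Fin n → X => f (Fin.cons a y)) (Measure.pi fun _ => μ) :=
      fun a => integrable_of_measurable_bounded _ (hfa a) fun y => hC _
    have hgc : ∀ a, |g a - g z| ≤ c := fun a => by
      rw [hg]
      simp only
      rw [← integral_sub (hfi a) (hfi z)]
      refine abs_integral_le_of_bounded _ fun y => ?_
      have h := hc (Fin.cons z y) 0 a
      rwa [Fin.update_cons_zero] at h
    set m := ∫ y, f y ∂Measure.pi (fun _ => μ) with hm
    have hmg : m = ∫ a, g a ∂μ := integral_pi_succ μ hf hC
    have hmC : |m| ≤ C := abs_integral_le_of_bounded _ hC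
    have hexpm : ∀ s : ℝ, Measurable fun x => Real.exp (t * (f x - s)) := fun s =>
      Real.measurable_exp.comp ((hf.sub_const s).const_mul t)
    have hb : ∀ s, |s| ≤ C → ∀ x, |Real.exp (t * (f x - s))| ≤ Real.exp (|t| * (C + C)) :=
      fun s hs x => exp_le_exp_of_abs_le ((abs_sub _ _).trans (add_le_add (hC x) hs))
    have hge : Measurable fun a => Real.exp (t * (g a - m)) :=
      Real.measurable_exp.comp ((hgm.sub_const m).const_mul t)
    rw [integral_pi_succ μ (hexpm m) (hb m hmC)]
    have hin : ∀ a, ∫ y, Real.exp (t * (f (Fin.cons a y) - m)) ∂Measure.pi (fun _ : Fin n => μ)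
        ≤ Real.exp (n * c ^ 2 * t ^ 2 / 2) * Real.exp (t * (g a - m)) := fun a => by
      have ih := integral_exp_le_of_boundedDifferences n (hfa a) (fun y => hC _) (fun y i b => by
        have h := hc (Fin.cons a y) i.succ b
        rwa [← Fin.cons_update] at h) t
      have e : ∀ y : Fin n → X, Real.exp (t * (f (Fin.cons a y) - m))
          = Real.exp (t * (f (Fin.cons a y) - g a)) * Real.exp (t * (g a - m)) := fun y => by
        rw [← Real.exp_add]
        ring_nf
      simp only [e]
      rw [integral_mul_const]
      exact mul_le_mul_of_nonneg_right ih (Real.exp_pos _).le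
    -- Centring the interval at `g z` gives length `2c` and variance proxy `c²`; this is where the
    -- optimal constant is lost.
    have hsub := (hasSubgaussianMGF_of_mem_Icc (μ := μ) (X := g) (a := g z - c) (b := g z + c)
      hgm.aemeasurable (Filter.Eventually.of_forall fun a => by
        have := abs_le.1 (hgc a)
        constructor <;> linarith [this.1, this.2])).mgf_le t
    rw [mgf, ← hmg] at hsub
    have hpar : (((‖g z + c - (g z - c)‖₊ / 2) ^ 2 : NNReal) : ℝ) = c ^ 2 := by
      push_cast
      rw [Real.norm_eq_abs, show g z + c - (g z - c) = 2 * c by ring, div_pow, sq_abs]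
      ring
    rw [hpar] at hsub
    calc _ ≤ ∫ a, Real.exp (n * c ^ 2 * t ^ 2 / 2) * Real.exp (t * (g a - m)) ∂μ := by
          refine integral_mono ?_ ?_ hin
          · exact integrable_of_measurable_bounded _ (measurable_integral_cons μ (hexpm m)) fun a =>
              abs_integral_le_of_bounded _ fun y => hb m hmC _
          · refine Integrable.const_mul ?_ _
            exact integrable_of_measurable_bounded _ hge fun a =>
              exp_le_exp_of_abs_le ((abs_sub _ _).trans (add_le_add (hgC a) hmC))
      _ ≤ Real.exp (n * c ^ 2 * t ^ 2 / 2) * Real.exp (c ^ 2 * t ^ 2 / 2) := by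
          rw [integral_const_mul]
          exact mul_le_mul_of_nonneg_left hsub (Real.exp_pos _).le
      _ = _ := by
          rw [← Real.exp_add]
          push_cast
          ring_nf

/-- **McDiarmid's inequality** (without the optimal constant). -/
theorem measure_ge_le_of_boundedDifferences {c : ℝ} {n : ℕ} {f : (Fin n → X) → ℝ} {C : ℝ}
    (hf : Measurable f) (hC : ∀ x, |f x| ≤ C)
    (hc : ∀ x i a, |f (Function.update x i a) - f x| ≤ c) {r : ℝ} (hr : 0 ≤ r) :
    (Measure.pi fun _ => μ).real {x | r ≤ f x - ∫ y, f y ∂Measure.pi (fun _ => μ)}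
      ≤ Real.exp (-r ^ 2 / (2 * (n * c ^ 2))) := by
  set m := ∫ y, f y ∂Measure.pi (fun _ => μ) with hm
  have hmC : |m| ≤ C := abs_integral_le_of_bounded _ hC
  have hsub : HasSubgaussianMGF (fun x => f x - m) (⟨n * c ^ 2, by positivity⟩ : NNReal)
      (Measure.pi fun _ => μ) :=
    ⟨fun t => integrable_of_measurable_bounded _
        (Real.measurable_exp.comp ((hf.sub_const m).const_mul t)) fun x =>
          exp_le_exp_of_abs_le ((abs_sub _ _).trans (add_le_add (hC x) hmC)),
      fun t => integral_exp_le_of_boundedDifferences μ n hf hC hc t⟩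
  exact hsub.measure_ge_le hr

end McDiarmid

/-! ### Concentration of Hilbert space valued means -/

section Bounds

variable {X F : Type*} [NormedAddCommGroup F] [InnerProductSpace ℝ F]

theorem norm_integral_le_of_bounded [MeasurableSpace X] (μ : Measure X)
    [IsProbabilityMeasure μ] {Φ : X → F} {B : ℝ} (hB : ∀ x, ‖Φ x‖ ≤ B) : ‖∫ y, Φ y ∂μ‖ ≤ B := by
  simpa using norm_integral_le_of_norm_le_const (μ := μ) (Filter.Eventually.of_forall hB)

theorem norm_mean_le_of_bounded {n : ℕ} (hn : 0 < n) {Φ : X → F} {B : ℝ} (hB : ∀ x, ‖Φ x‖ ≤ B) (x : Fin n → X) :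
    ‖(n : ℝ)⁻¹ • ∑ j, Φ (x j)‖ ≤ B := by
  have hn' : (0 : ℝ) < n := Nat.cast_pos.2 hn
  rw [norm_smul, norm_inv, Real.norm_natCast, inv_mul_le_iff₀ hn']
  refine (norm_sum_le _ _).trans ((Finset.sum_le_sum fun j _ => hB _).trans ?_)
  simp

end Bounds

section HilbertMean

variable {X : Type*} [TopologicalSpace X] [CompactSpace X]
  [MeasurableSpace X] [BorelSpace X] {F : Type*} [NormedAddCommGroup F] [InnerProductSpace ℝ F]
  (μ : Measure X) [IsProbabilityMeasure μ]

theorem integrable_continuousMap {F : Type*} [NormedAddCommGroup F] (ν : Measure X)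
    [IsFiniteMeasure ν] (Y : C(X, F)) : Integrable Y ν :=
  Y.continuous.integrable_of_hasCompactSupport (HasCompactSupport.of_compactSpace _)

variable [SecondCountableTopology X]

/-- Pythagoras for independent centred vectors. The free vector `a` absorbs the first summand, which
closes the induction. -/
theorem integral_norm_add_sum_sq [CompleteSpace F] {Y : C(X, F)} (hY : ∫ x, Y x ∂μ = 0) :
    ∀ (n : ℕ) (a : F), ∫ x, ‖a + ∑ j, Y (x j)‖ ^ 2 ∂Measure.pi (fun _ : Fin n => μ)
      = ‖a‖ ^ 2 + n * ∫ x, ‖Y x‖ ^ 2 ∂μ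
  | 0, a => by simp
  | n + 1, a => by
    have hcont : Continuous fun x : Fin (n + 1) → X => ‖a + ∑ j, Y (x j)‖ ^ 2 := by fun_prop
    rw [integral_pi_succ μ (C := (‖a‖ + ∑ j : Fin (n + 1), ‖Y‖) ^ 2) hcont.measurable fun x => by
      rw [abs_of_nonneg (by positivity)]
      gcongr
      refine (norm_add_le _ _).trans ?_
      gcongr
      exact (norm_sum_le _ _).trans (Finset.sum_le_sum fun j _ => Y.norm_coe_le_norm _)]
    have h1 : ∀ b, ∫ y, ‖a + ∑ j, Y ((Fin.cons b y : Fin (n + 1) → X) j)‖ ^ 2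
        ∂Measure.pi (fun _ : Fin n => μ) = ‖a + Y b‖ ^ 2 + n * ∫ x, ‖Y x‖ ^ 2 ∂μ := fun b => by
      rw [← integral_norm_add_sum_sq hY n (a + Y b)]
      refine integral_congr_ae (Filter.Eventually.of_forall fun y => ?_)
      simp only [Fin.sum_univ_succ, Fin.cons_zero, Fin.cons_succ, add_assoc]
    simp only [h1]
    have i1 : Integrable (fun b => inner ℝ a (Y b)) μ :=
      integrable_continuousMap μ ⟨fun b => inner ℝ a (Y b), by fun_prop⟩
    have i2 : Integrable (fun b => ‖Y b‖ ^ 2) μ :=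
      integrable_continuousMap μ ⟨fun b => ‖Y b‖ ^ 2, by fun_prop⟩
    have i3 : ∫ b, inner ℝ a (Y b) ∂μ = 0 := by
      rw [integral_inner (integrable_continuousMap μ Y), hY, inner_zero_right]
    simp only [norm_add_sq_real]
    have i4 : Integrable (fun b => ‖a‖ ^ 2 + 2 * inner ℝ a (Y b)) μ :=
      (integrable_const _).add (i1.const_mul 2)
    have i5 : Integrable (fun b => ‖a‖ ^ 2 + 2 * inner ℝ a (Y b) + ‖Y b‖ ^ 2) μ := i4.add i2
    rw [integral_add i5 (integrable_const _), integral_add i4 i2,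
      integral_add (integrable_const _) (i1.const_mul 2), integral_const_mul, i3]
    simp
    ring

/-- The deviation of the empirical mean of a Hilbert space valued map from its expectation. -/
def meanDeviation {n : ℕ} (Φ : C(X, F)) (x : Fin n → X) : ℝ :=
  ‖∫ y, Φ y ∂μ - (n : ℝ)⁻¹ • ∑ j, Φ (x j)‖

variable {Φ : C(X, F)} {B : ℝ}

/-- The second moment is at most `B²/n` by orthogonality of the centred summands; nonnegativity of
the variance passes to the first moment. -/
theorem integral_meanDeviation_le [CompleteSpace F] {n : ℕ} (hn : 0 < n) (hB0 : 0 ≤ B) (hB : ∀ x, ‖Φ x‖ ≤ B) :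
    ∫ x, meanDeviation μ Φ x ∂Measure.pi (fun _ : Fin n => μ) ≤ B / √n := by
  have hn' : (0 : ℝ) < n := Nat.cast_pos.2 hn
  set m := ∫ y, Φ y ∂μ with hm
  let Y : C(X, F) := ⟨fun x => Φ x - m, by fun_prop⟩
  have hY : ∫ x, Y x ∂μ = 0 := by
    change ∫ x, (Φ x - m) ∂μ = 0
    rw [integral_sub (integrable_continuousMap μ Φ) (integrable_const _)]
    simp [hm]
  have hY2 : ∫ x, ‖Y x‖ ^ 2 ∂μ ≤ B ^ 2 := by
    have i1 : Integrable (fun b => inner ℝ m (Φ b)) μ :=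
      integrable_continuousMap μ ⟨fun b => inner ℝ m (Φ b), by fun_prop⟩
    have i2 : Integrable (fun b => ‖Φ b‖ ^ 2) μ :=
      integrable_continuousMap μ ⟨fun b => ‖Φ b‖ ^ 2, by fun_prop⟩
    have e : ∀ x, ‖Y x‖ ^ 2 = ‖Φ x‖ ^ 2 - 2 * inner ℝ m (Φ x) + ‖m‖ ^ 2 := fun x => by
      change ‖Φ x - m‖ ^ 2 = _
      rw [norm_sub_sq_real, real_inner_comm]
    simp only [e]
    have i3 : Integrable (fun x => ‖Φ x‖ ^ 2 - 2 * inner ℝ m (Φ x)) μ := i2.sub (i1.const_mul 2)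
    rw [integral_add i3 (integrable_const _), integral_sub i2 (i1.const_mul 2), integral_const_mul,
      integral_inner (integrable_continuousMap μ Φ), ← hm, real_inner_self_eq_norm_sq]
    have h1 : ∫ x, ‖Φ x‖ ^ 2 ∂μ ≤ B ^ 2 := by
      refine (le_abs_self _).trans (abs_integral_le_of_bounded _ fun x => ?_)
      rw [abs_of_nonneg (sq_nonneg _)]
      exact pow_le_pow_left₀ (norm_nonneg _) (hB x) 2
    simp
    nlinarith [sq_nonneg ‖m‖]
  have hdev : ∀ x : Fin n → X, meanDeviation μ Φ x ^ 2 = ((n : ℝ)⁻¹) ^ 2 * ‖0 + ∑ j, Y (x j)‖ ^ 2 :=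
    fun x => by
      have e : ∫ y, Φ y ∂μ - (n : ℝ)⁻¹ • ∑ j, Φ (x j) = -((n : ℝ)⁻¹ • ∑ j, Y (x j)) := by
        change _ = -((n : ℝ)⁻¹ • ∑ j, (Φ (x j) - m))
        rw [Finset.sum_sub_distrib, smul_sub, Finset.sum_const, Finset.card_univ, Fintype.card_fin,
          ← Nat.cast_smul_eq_nsmul ℝ, inv_smul_smul₀ hn'.ne', neg_sub]
      rw [meanDeviation, e, norm_neg, norm_smul, zero_add, norm_inv, Real.norm_natCast, mul_pow]
  have hcont : Continuous fun x : Fin n → X => meanDeviation μ Φ x := by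
    unfold meanDeviation
    fun_prop
  have hsq : ∫ x, meanDeviation μ Φ x ^ 2 ∂Measure.pi (fun _ : Fin n => μ) ≤ (B / √n) ^ 2 := by
    simp only [hdev]
    rw [integral_const_mul, integral_norm_add_sum_sq μ hY, norm_zero, div_pow,
      Real.sq_sqrt n.cast_nonneg]
    have : ((n : ℝ)⁻¹) ^ 2 * (0 ^ 2 + n * ∫ x, ‖Y x‖ ^ 2 ∂μ) = (∫ x, ‖Y x‖ ^ 2 ∂μ) / n := by
      field_simp
      ring
    rw [this]
    gcongr
  set ν := Measure.pi (fun _ : Fin n => μ)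
  have i1 : Integrable (fun x : Fin n → X => meanDeviation μ Φ x) ν :=
    integrable_continuousMap ν ⟨_, hcont⟩
  have i2 : Integrable (fun x : Fin n → X => meanDeviation μ Φ x ^ 2) ν :=
    integrable_continuousMap ν ⟨_, hcont.pow 2⟩
  set A := ∫ x, meanDeviation μ Φ x ∂ν with hA
  have hvar : 0 ≤ ∫ x, (meanDeviation μ Φ x - A) ^ 2 ∂ν := integral_nonneg fun x => sq_nonneg _
  have e2 : ∀ x : Fin n → X, (meanDeviation μ Φ x - A) ^ 2
      = meanDeviation μ Φ x ^ 2 - 2 * A * meanDeviation μ Φ x + A ^ 2 := fun x => by ring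
  simp only [e2] at hvar
  have i3 : Integrable (fun x : Fin n → X =>
      meanDeviation μ Φ x ^ 2 - 2 * A * meanDeviation μ Φ x) ν := i2.sub (i1.const_mul _)
  rw [integral_add i3 (integrable_const _), integral_sub i2 (i1.const_mul _),
    integral_const_mul, ← hA] at hvar
  simp at hvar
  exact abs_le_of_sq_le_sq' (by nlinarith) (by positivity) |>.2

/-- Concentration of the empirical mean of a bounded Hilbert space valued map. -/
theorem measure_meanDeviation_gt_le [CompleteSpace F] {n : ℕ} (hn : 0 < n) (hB : ∀ x, ‖Φ x‖ ≤ B) {θ : ℝ}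
    (hθ : 1 ≤ θ) :
    (Measure.pi fun _ : Fin n => μ).real {x | 4 * √2 * B * √(θ / n) < meanDeviation μ Φ x}
      ≤ Real.exp (-θ) := by
  have hn' : (0 : ℝ) < n := Nat.cast_pos.2 hn
  obtain ⟨z⟩ : Nonempty X := Measure.nonempty_of_neZero μ
  have hB0 : 0 ≤ B := (norm_nonneg _).trans (hB z)
  have hdev2 : ∀ x : Fin n → X, meanDeviation μ Φ x ≤ 2 * B := fun x => by
    refine (norm_sub_le _ _).trans ?_
    linarith [norm_integral_le_of_bounded μ hB, norm_mean_le_of_bounded hn hB x]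
  -- For `B = 0` the exponent below would be `0/0`; the event is empty because its inequality is
  -- strict.
  rcases hB0.eq_or_lt with h0 | hBpos
  · have : {x : Fin n → X | 4 * √2 * B * √(θ / n) < meanDeviation μ Φ x} = ∅ := by
      refine Set.eq_empty_of_forall_notMem fun x hx => ?_
      have h1 : 4 * √2 * B * √(θ / n) < meanDeviation μ Φ x := hx
      have h2 := hdev2 x
      rw [← h0] at h1 h2
      simp at h1 h2
      linarith
    rw [this]
    simpa using (Real.exp_pos _).le
  have hcont : Continuous fun x : Fin n → X => meanDeviation μ Φ x := by
    unfold meanDeviation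
    fun_prop
  have hbd : ∀ (x : Fin n → X) i a, |meanDeviation μ Φ (Function.update x i a)
      - meanDeviation μ Φ x| ≤ 2 * B / n := fun x i a => by
    refine (abs_norm_sub_norm_le _ _).trans ?_
    have e : ∑ j, Φ (x j) - ∑ j, Φ (Function.update x i a j) = Φ (x i) - Φ a := by
      rw [← Finset.sum_sub_distrib, Finset.sum_eq_single i]
      · simp
      · intro j _ hj
        simp [hj]
      · simp
    rw [sub_sub_sub_cancel_left, ← smul_sub, e, norm_smul, norm_inv, Real.norm_natCast,
      inv_mul_eq_div]
    gcongr
    refine (norm_sub_le _ _).trans ?_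
    linarith [hB (x i), hB a]
  -- With differences `2B/n`, this `r` makes the exponent exactly `-θ`. As `θ ≥ 1`, the mean is at
  -- most `B√(θ/n)`, and `1 + 2√2 ≤ 4√2` leaves room for it.
  have hmc := measure_ge_le_of_boundedDifferences μ hcont.measurable (C := 2 * B) (fun x => by
    rw [meanDeviation, abs_of_nonneg (norm_nonneg _)]
    exact hdev2 x) hbd (r := 2 * √2 * B * √(θ / n)) (by positivity)
  have hexp : -(2 * √2 * B * √(θ / n)) ^ 2 / (2 * (n * (2 * B / n) ^ 2)) = -θ := by
    rw [mul_pow, mul_pow, mul_pow, Real.sq_sqrt (by positivity), Real.sq_sqrt (by positivity)]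
    field_simp
  rw [hexp] at hmc
  refine le_trans (measureReal_mono fun x hx => ?_) hmc
  have hx' : 4 * √2 * B * √(θ / n) < meanDeviation μ Φ x := hx
  have hE := integral_meanDeviation_le μ hn hB0 hB
  have h1 : B / √n ≤ B * √(θ / n) := by
    rw [div_eq_mul_inv]
    refine mul_le_mul_of_nonneg_left ?_ hB0
    rw [← Real.sqrt_inv]
    refine Real.sqrt_le_sqrt ?_
    rw [inv_eq_one_div]
    gcongr
  have h2 : (1 : ℝ) ≤ √2 := Real.one_le_sqrt.2 one_le_two
  have h3 : 0 ≤ B * √(θ / n) := by positivity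
  change _ ≤ meanDeviation μ Φ x - _
  nlinarith

end HilbertMean

/-! ### Feature maps of kernels and the deterministic error bound -/

section KernelFeature

/-- A continuous positive semidefinite kernel has a continuous feature map into a Hilbert space. -/
theorem exists_continuous_feature.{u} {X : Type u} [TopologicalSpace X] (K : C(X × X, ℝ))
    (hK : (Matrix.of fun x y => K (x, y)).PosSemidef) :
    ∃ (H : Type u) (_ : NormedAddCommGroup H) (_ : InnerProductSpace ℝ H) (_ : CompleteSpace H)
      (φ : C(X, H)), ∀ x y, inner ℝ (φ x) (φ y) = K (x, y) := by
  have hsymm : ∀ x y, K (y, x) = K (x, y) := fun x y => hK.1.apply x y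
  -- The scalar kernel is recast as an operator-valued one on `ℝ` in order to form its reproducing
  -- kernel Hilbert space.
  let L : Matrix X X (ℝ →L[ℝ] ℝ) := Matrix.of fun x y => K (x, y) • (1 : ℝ →L[ℝ] ℝ)
  have hL : L.PosSemidef := by
    have htfae := (RKHS.posSemidef_tfae (K := L)).out 0 2
    refine htfae.2 ⟨?_, fun v => ?_⟩
    · refine Matrix.IsHermitian.ext fun x y => ?_
      change star (K (y, x) • (1 : ℝ →L[ℝ] ℝ)) = K (x, y) • 1
      rw [star_smul, star_one, hsymm]
      rfl
    · refine (hK.2 v).trans (le_of_eq ?_)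
      change _ = v.sum fun x w => v.sum fun x' w' => inner ℝ (K (x', x) * w) w'
      refine Finsupp.sum_congr fun x _ => Finsupp.sum_congr fun y _ => ?_
      rw [hsymm]
      simp
      ring
  have : Fact L.PosSemidef := ⟨hL⟩
  let φ : X → RKHS.OfKernel L := fun x => RKHS.kerFun (RKHS.OfKernel L) x 1
  have hφ : ∀ x y, inner ℝ (φ x) (φ y) = K (x, y) := fun x y => by
    have h := RKHS.kernel_inner (RKHS.OfKernel L) y x (1 : ℝ) (1 : ℝ)
    rw [RKHS.OfKernel.kernel_ofKernel] at h
    rw [← h, ← hsymm]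
    change inner ℝ (K (y, x) * 1) (1 : ℝ) = _
    simp
  refine ⟨RKHS.OfKernel L, inferInstance, inferInstance, inferInstance, ⟨φ, ?_⟩, hφ⟩
  rw [continuous_iff_continuousAt]
  intro x₀
  rw [ContinuousAt, tendsto_iff_norm_sub_tendsto_zero]
  have h : ∀ x, ‖φ x - φ x₀‖ = √(K (x, x) - 2 * K (x, x₀) + K (x₀, x₀)) := fun x => by
    rw [← hφ, ← hφ, ← hφ, real_inner_self_eq_norm_sq, real_inner_self_eq_norm_sq,
      ← norm_sub_sq_real, Real.sqrt_sq (norm_nonneg _)]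
  simp only [h]
  have hc : Continuous fun x => √(K (x, x) - 2 * K (x, x₀) + K (x₀, x₀)) := by fun_prop
  have h0 := hc.tendsto x₀
  rwa [show K (x₀, x₀) - 2 * K (x₀, x₀) + K (x₀, x₀) = 0 by ring, Real.sqrt_zero] at h0

variable {X : Type*} [TopologicalSpace X]

theorem kernelSup_nonneg (K : C(X × X, ℝ)) : 0 ≤ kernelSup K :=
  Real.iSup_nonneg fun _ => abs_nonneg _

variable [CompactSpace X]

theorem le_kernelSup (K : C(X × X, ℝ)) (p : X × X) : K p ≤ kernelSup K := by
  refine (le_abs_self _).trans (le_ciSup (f := fun p => |K p|) ⟨‖K‖, ?_⟩ p)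
  rintro _ ⟨q, rfl⟩
  exact K.norm_coe_le_norm q

variable {E G : Type*} [NormedAddCommGroup E] [InnerProductSpace ℝ E]
  [NormedAddCommGroup G] [InnerProductSpace ℝ G] {K₀ K₁ : C(X × X, ℝ)} {φ : C(X, G)} {ψ : C(X, E)}

theorem norm_feature_le (hφ : ∀ x y, inner ℝ (φ x) (φ y) = K₀ (x, y)) (x : X) :
    ‖φ x‖ ≤ √(kernelSup K₀) := by
  rw [norm_eq_sqrt_real_inner, hφ]
  exact Real.sqrt_le_sqrt (le_kernelSup K₀ _)

theorem norm_featureTensor_le (hφ : ∀ x y, inner ℝ (φ x) (φ y) = K₀ (x, y))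
    (hψ : ∀ x y, inner ℝ (ψ x) (ψ y) = K₁ (x, y)) (x : X) :
    ‖featureTensor φ ψ x‖ ≤ √(kernelSup K₀) * √(kernelSup K₁) := by
  rw [norm_featureTensor]
  exact mul_le_mul (norm_feature_le hφ x) (norm_feature_le hψ x) (norm_nonneg _)
    (Real.sqrt_nonneg _)

variable [SecondCountableTopology X] [MeasurableSpace X] [BorelSpace X] [CompleteSpace E]
  [CompleteSpace G]

/-- Outside of the event that the empirical cross-covariance deviates, the entropic part of the
estimator is close to that of the regularized distance between the covariance operators. -/
theorem abs_opW2_sub_empW2_le (ρ : Measure X) [IsProbabilityMeasure ρ]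
    (hK₀ : (Matrix.of fun x y => K₀ (x, y)).PosSemidef)
    (hK₁ : (Matrix.of fun x y => K₁ (x, y)).PosSemidef)
    (hφ : ∀ x y, inner ℝ (φ x) (φ y) = K₀ (x, y)) (hψ : ∀ x y, inner ℝ (ψ x) (ψ y) = K₁ (x, y))
    {ε : ℝ} (hε : 0 < ε) {n : ℕ} (hn : 0 < n) (x : Fin n → X) {δ : ℝ}
    (hx : meanDeviation ρ (featureTensor φ ψ) x
      ≤ 4 * √2 * (√(kernelSup K₀) * √(kernelSup K₁)) * δ) :
    |(opW2 ε (covOp ρ K₀) (covOp ρ K₁) - (opTrace (covOp ρ K₀) + opTrace (covOp ρ K₁)))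
      - (empW2 ε K₀ K₁ x - ((gramMat K₀ x).trace + (gramMat K₁ x).trace))|
      ≤ 16 * √2 * (kernelSup K₀ * kernelSup K₁) / ε * δ := by
  obtain ⟨ι, s, u, w, hsvd, h1⟩ := exists_isSVD_opW2 ρ hφ hψ ε
  obtain ⟨κ, t, p, q, hsvd', h2⟩ := exists_isSVD_empW2 hK₀ hK₁ hφ hψ hε x
  have hB := norm_featureTensor_le hφ hψ
  have h3 := hsvd.abs_tsum_entropyFun_sub_le (represents_featureOp ρ φ ψ) hsvd'
    (represents_sampleOp φ ψ x) (a := 4 / ε) (by positivity) (norm_integral_le_of_bounded ρ hB)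
    (norm_mean_le_of_bounded hn hB x)
  rw [h1, h2, Matrix.trace_add]
  set a := ∑' i, entropyFun (4 / ε * s i)
  set b := ∑' j, entropyFun (4 / ε * t j)
  have hsq : (√(kernelSup K₀) * √(kernelSup K₁)) ^ 2 = kernelSup K₀ * kernelSup K₁ := by
    rw [mul_pow, Real.sq_sqrt (kernelSup_nonneg _), Real.sq_sqrt (kernelSup_nonneg _)]
  -- The constant is `(ε/2) · (4/ε)²/2 · 4√2 = 16√2/ε`.
  calc _ = ε / 2 * |a - b| := by
        rw [← abs_of_pos (half_pos hε), ← abs_mul, ← abs_neg]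
        congr 1
        rw [abs_of_pos (half_pos hε)]
        ring
    _ ≤ ε / 2 * ((4 / ε) ^ 2 / 2 * (√(kernelSup K₀) * √(kernelSup K₁))
          * (4 * √2 * (√(kernelSup K₀) * √(kernelSup K₁)) * δ)) := by
        refine mul_le_mul_of_nonneg_left (h3.trans ?_) (half_pos hε).le
        exact mul_le_mul_of_nonneg_left hx (by positivity)
    _ = ε / 2 * ((4 / ε) ^ 2 / 2 * (4 * √2)) * (√(kernelSup K₀) * √(kernelSup K₁)) ^ 2 * δ := by
        ring
    _ = _ := by
        rw [hsq]
        field_simp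
        ring

end KernelFeature

/-! ### Transfer to an i.i.d. sample -/

section Probability

variable {X : Type*} [TopologicalSpace X] [CompactSpace X] [SecondCountableTopology X]
  [MeasurableSpace X] [BorelSpace X] {F : Type*} [NormedAddCommGroup F] [InnerProductSpace ℝ F]
  [CompleteSpace F]

theorem measure_meanDeviation_comp_gt_le {ρ : Measure X} [IsProbabilityMeasure ρ] {Φ : C(X, F)}
    {B : ℝ} (hB : ∀ x, ‖Φ x‖ ≤ B) {Ω : Type*} [MeasurableSpace Ω] {P : Measure Ω}
    [IsProbabilityMeasure P] {n : ℕ} (hn : 0 < n) {x : Fin n → Ω → X}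
    (hlaw : ∀ i, HasLaw (x i) ρ P) (hindep : iIndepFun x P) {θ : ℝ} (hθ : 1 ≤ θ) :
    P.real {ω | 4 * √2 * B * √(θ / n) < meanDeviation ρ Φ fun i => x i ω} ≤ Real.exp (-θ) := by
  have hm : AEMeasurable (fun ω i => x i ω) P := aemeasurable_pi_lambda _ fun i => (hlaw i).aemeasurable
  have hmap : P.map (fun ω i => x i ω) = Measure.pi fun _ => ρ := by
    rw [(iIndepFun_iff_map_fun_eq_pi_map fun i => (hlaw i).aemeasurable).1 hindep]
    simp only [(hlaw _).map_eq]
  have hcont : Continuous fun x : Fin n → X => meanDeviation ρ Φ x := by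
    unfold meanDeviation
    fun_prop
  have hset : MeasurableSet {x : Fin n → X | 4 * √2 * B * √(θ / n) < meanDeviation ρ Φ x} :=
    measurableSet_lt measurable_const hcont.measurable
  have h := measure_meanDeviation_gt_le ρ hn hB hθ
  rwa [← hmap, map_measureReal_apply_of_aemeasurable hm hset] at h

end Probability

end GPSinkhorn

end

/-! ### The concentration theorem -/

theorem mainTheorem5 {d : ℕ} (𝒳 : Set (EuclideanSpace ℝ (Fin d))) [CompactSpace 𝒳]
    (ρ : Measure 𝒳) [IsProbabilityMeasure ρ]
    (K₀ K₁ : C(𝒳 × 𝒳, ℝ))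
    (hK₀ : (Matrix.of fun x y => K₀ (x, y)).PosSemidef)
    (hK₁ : (Matrix.of fun x y => K₁ (x, y)).PosSemidef)
    {Ω : Type*} [MeasurableSpace Ω] (P : Measure Ω) [IsProbabilityMeasure P]
    {n : ℕ} (hn : 0 < n) (x : Fin n → Ω → 𝒳)
    (hlaw : ∀ i, HasLaw (x i) ρ P) (hindep : iIndepFun x P)
    {ε : ℝ} (hε : 0 < ε) {θ : ℝ} (hθ : 0 ≤ θ) :
    1 - 4 * Real.exp (-θ) ≤ P.real {ω |
      |GPSinkhorn.opSinkhorn ε (GPSinkhorn.covOp ρ K₀) (GPSinkhorn.covOp ρ K₁)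
          - GPSinkhorn.empSinkhorn ε K₀ K₁ (fun i => x i ω)|
        ≤ 8 * √2 * (GPSinkhorn.kernelSup K₀ + GPSinkhorn.kernelSup K₁) ^ 2 / ε
          * √(θ / n)} := by
  -- For `θ < 1` the claimed probability is at most `0`, since `e < 4`.
  rcases lt_or_ge θ 1 with hθ1 | hθ1
  · have h1 : Real.exp (-1) ≤ Real.exp (-θ) := Real.exp_le_exp.2 (by linarith)
    have h2 : (1 : ℝ) / 4 ≤ Real.exp (-1) := by
      rw [Real.exp_neg, one_div]
      exact inv_anti₀ (Real.exp_pos 1) (by linarith [Real.exp_one_lt_d9])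
    exact (by linarith : 1 - 4 * Real.exp (-θ) ≤ 0).trans measureReal_nonneg
  obtain ⟨G, _, _, _, φ, hφ⟩ := GPSinkhorn.exists_continuous_feature K₀ hK₀
  obtain ⟨E, _, _, _, ψ, hψ⟩ := GPSinkhorn.exists_continuous_feature K₁ hK₁
  set S := {ω | |GPSinkhorn.opSinkhorn ε (GPSinkhorn.covOp ρ K₀) (GPSinkhorn.covOp ρ K₁)
          - GPSinkhorn.empSinkhorn ε K₀ K₁ (fun i => x i ω)|
        ≤ 8 * √2 * (GPSinkhorn.kernelSup K₀ + GPSinkhorn.kernelSup K₁) ^ 2 / ε * √(θ / n)}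
  have b01 := GPSinkhorn.measure_meanDeviation_comp_gt_le
    (GPSinkhorn.norm_featureTensor_le hφ hψ) hn hlaw hindep hθ1
  have b00 := GPSinkhorn.measure_meanDeviation_comp_gt_le
    (GPSinkhorn.norm_featureTensor_le hφ hφ) hn hlaw hindep hθ1
  have b11 := GPSinkhorn.measure_meanDeviation_comp_gt_le
    (GPSinkhorn.norm_featureTensor_le hψ hψ) hn hlaw hindep hθ1
  set A01 := {ω | _ < GPSinkhorn.meanDeviation ρ (GPSinkhorn.featureTensor φ ψ) fun i => x i ω}
  set A00 := {ω | _ < GPSinkhorn.meanDeviation ρ (GPSinkhorn.featureTensor φ φ) fun i => x i ω}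
  set A11 := {ω | _ < GPSinkhorn.meanDeviation ρ (GPSinkhorn.featureTensor ψ ψ) fun i => x i ω}
  -- Covering `Ω` and using subadditivity avoids any measurability of `S` or of the exceptional
  -- events.
  have hcover : (Set.univ : Set Ω) ⊆ S ∪ (A01 ∪ (A00 ∪ A11)) := fun ω _ => by
    by_contra hω
    simp only [Set.mem_union, not_or] at hω
    obtain ⟨hS, h01, h00, h11⟩ := hω
    refine hS ?_
    have e01 := GPSinkhorn.abs_opW2_sub_empW2_le ρ hK₀ hK₁ hφ hψ hε hn _ (not_lt.1 h01)
    have e00 := GPSinkhorn.abs_opW2_sub_empW2_le ρ hK₀ hK₀ hφ hφ hε hn _ (not_lt.1 h00)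
    have e11 := GPSinkhorn.abs_opW2_sub_empW2_le ρ hK₁ hK₁ hψ hψ hε hn _ (not_lt.1 h11)
    have hsplit : 8 * √2 * (GPSinkhorn.kernelSup K₀ + GPSinkhorn.kernelSup K₁) ^ 2 / ε * √(θ / n)
        = 16 * √2 * (GPSinkhorn.kernelSup K₀ * GPSinkhorn.kernelSup K₁) / ε * √(θ / n)
          + 1 / 2 * (16 * √2 * (GPSinkhorn.kernelSup K₀ * GPSinkhorn.kernelSup K₀) / ε * √(θ / n)
          + 16 * √2 * (GPSinkhorn.kernelSup K₁ * GPSinkhorn.kernelSup K₁) / ε * √(θ / n)) := by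
      ring
    change |GPSinkhorn.opSinkhorn ε (GPSinkhorn.covOp ρ K₀) (GPSinkhorn.covOp ρ K₁)
      - GPSinkhorn.empSinkhorn ε K₀ K₁ (fun i => x i ω)| ≤ _
    rw [hsplit, GPSinkhorn.opSinkhorn, GPSinkhorn.empSinkhorn]
    rw [abs_le] at e01 e00 e11 ⊢
    constructor <;> linarith [e01.1, e01.2, e00.1, e00.2, e11.1, e11.2]
  have h1 : 1 ≤ P.real S + (P.real A01 + (P.real A00 + P.real A11)) := by
    calc (1 : ℝ) = P.real Set.univ := probReal_univ.symm
      _ ≤ P.real (S ∪ (A01 ∪ (A00 ∪ A11))) := measureReal_mono hcover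
      _ ≤ P.real S + P.real (A01 ∪ (A00 ∪ A11)) := measureReal_union_le _ _
      _ ≤ P.real S + (P.real A01 + P.real (A00 ∪ A11)) := by
        gcongr
        exact measureReal_union_le _ _
      _ ≤ _ := by
        gcongr
        exact measureReal_union_le _ _
  -- Only three exceptional events occur; the fourth `exp (-θ)` is slack.
  linarith [Real.exp_pos (-θ)]
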